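/- **Setting.** Let $S$ be a compact smooth manifold of dimension $m\ge 1$ with a smooth Riemannian metric $G=(G_{AB})$, with volume measure and Laplace operator $\Delta$ taken with respect to $G$. Let $n\ge 2$ be an integer, $\alpha_M>0$, and let $V,\Lambda,\tilde\kappa\in\mathbb R$. Put $$a_0=\frac{2n(n-1)}{\alpha_M},\qquad \bar V=\frac{\alpha_M}{n(n-1)}V,\qquad \bar\Lambda=\frac{2}{n(n-1)}\Lambda .$$ Let $\mathcal H_0\subset L^2(S,\mathbb C)$ be the subspace spanned by the eigenspaces of $-\Delta$ belonging to those eigenvalues $\mu$ for which $$\bar\mu=\tfrac{4}{n^2}a_0\mu-\tfrac{(m-1)^2}{4}\le 0 .$$ For an open interval $I\subset(0,\infty)$ let $L^2(I,1)$ be the Hilbert space of complex functions $u$ on $I$ with $\int_I r|u|^2\,dr<\infty$, and let $L^2(I,1)\otimes\mathcal H_0$ be the Hilbert space tensor product. On $C_c^\infty(I)\otimes\mathcal H_0$ consider the Hamilton operator $$H\psi=r^{-1}\frac{\partial}{\partial r}\Big(r\frac{\partial\psi}{\partial r}\Big)+r^{-2}\Big(-\frac4{n^2}a_0\Delta\psi-\frac{(m-1)^2}{4}\psi\Big)+\frac{16}{n^2}(\bar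 V+\bar\Lambda)r^2\psi-\frac{16}{n^2}\tilde\kappa\, r^{\frac{2(n-2)}{n}}\psi .$$ We say that *$H$ is selfadjoint in $L^2(I,1)\otimes\mathcal H_0$* if $H$, on $C_c^\infty(I)\otimes\mathcal H_0$, is a well-defined, densely defined, symmetric operator that is bounded above, $\langle H\psi,\psi\rangle\le c\|\psi\|^2$, and its Friedrichs extension extends it and is selfadjoint. Here the Friedrichs extension is the operator $\psi\mapsto H\psi$ with domain the set of all $\psi\in L^2(I,1)\otimes\mathcal H_0$ such that * $\psi$ belongs to the form domain of $H$: there are $\varphi_k\in C_c^\infty(I)\otimes\mathcal H_0$ with $\varphi_k\to\psi$ and $\langle H(\varphi_j-\varphi_k),\varphi_j-\varphi_k\rangle\to0$ as $j,k\to\infty$; and * $H\psi\in L^2(I,1)\otimes\mathcal H_0$ in the distributional sense: there is $\chi=:H\psi$ in this space with $\langle\psi,H\varphi\rangle=\langle\chi,\varphi\rangle$ for all $\varphi\in C_c^\infty(I)\otimes\mathcal H_0$. **Theorem 1.4.** The Hamilton operator $H$ is selfadjoint in $L^2((0,r_0),1)\otimes\mathcal H_0$ for every $r_0>0$ and arbitrary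 values of $\bar V$, $\bar\Lambda$ and $\tilde\kappa$. It is also selfadjoint in $L^2((0,\infty),1)\otimes\mathcal H_0$ if $$\bar V+\bar\Lambda\le0\quad\text{and}\quad\tilde\kappa\ge0,$$ or if $$\bar V+\bar\Lambda<0\quad\text{and}\quad\tilde\kappa\ \text{is arbitrary}.$$ -/

import Mathlib

open MeasureTheory Set Filter Topology
open scoped Manifold ContDiff TensorProduct InnerProductSpace

namespace FriedmanQC

noncomputable section

/-! ### Compact Riemannian manifolds: volume measure and Laplace operator -/

section Matter

variable {m : ℕ} {S : Type*} [TopologicalSpace S] [ChartedSpace (EuclideanSpace ℝ (Fin m)) S]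

/-- A smooth Riemannian metric on the `m`-dimensional manifold `S`. -/
abbrev Metric (m : ℕ) (S : Type*) [TopologicalSpace S]
    [ChartedSpace (EuclideanSpace ℝ (Fin m)) S] [IsManifold (𝓡 m) ∞ S] :=
  Bundle.ContMDiffRiemannianMetric (𝓡 m) ∞ (EuclideanSpace ℝ (Fin m))
    (fun y : S => TangentSpace (𝓡 m) y)

/-- The coordinate vector field `∂/∂y^A` of the chart around `x₀`, at the point with
coordinates `z`. -/
def coordVec (x₀ : S) (z : EuclideanSpace ℝ (Fin m)) (A : Fin m) :
    TangentSpace (𝓡 m) ((extChartAt (𝓡 m) x₀).symm z) :=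
  mfderiv 𝓘(ℝ, EuclideanSpace ℝ (Fin m)) (𝓡 m) (extChartAt (𝓡 m) x₀).symm z
    (EuclideanSpace.single A (1 : ℝ))

variable [IsManifold (𝓡 m) ∞ S]

/-- The matrix `(G_{AB})` of the metric in the chart around `x₀`. -/
def metricMatrix (G : Metric m S) (x₀ : S) (z : EuclideanSpace ℝ (Fin m)) :
    Matrix (Fin m) (Fin m) ℝ :=
  Matrix.of fun A B =>
    G.inner ((extChartAt (𝓡 m) x₀).symm z) (coordVec x₀ z A) (coordVec x₀ z B)

/-- The density `√det (G_{AB})` in the chart around `x₀`. -/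
def volDensity (G : Metric m S) (x₀ : S) (z : EuclideanSpace ℝ (Fin m)) : ℝ :=
  √(metricMatrix G x₀ z).det

/-- The Laplace operator in the chart around `x₀`, applied to a function `F` of the coordinates:
`ΔF = (√G)⁻¹ ∂_A (√G G^{AB} ∂_B F)`. -/
def chartLaplacian (G : Metric m S) (x₀ : S) (F : EuclideanSpace ℝ (Fin m) → ℂ)
    (z : EuclideanSpace ℝ (Fin m)) : ℂ :=
  (volDensity G x₀ z)⁻¹ • ∑ A : Fin m,
    fderiv ℝ (fun w => ∑ B : Fin m,
      (volDensity G x₀ w * (metricMatrix G x₀ w)⁻¹ A B) •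
        fderiv ℝ F w (EuclideanSpace.single B (1 : ℝ))) z (EuclideanSpace.single A (1 : ℝ))

/-- `f` is a smooth function on `S` and `Δf = h`, where `Δ` is the Laplace-Beltrami operator of
`G`, expressed in local coordinates. -/
def HasLaplacian (G : Metric m S) (f h : S → ℂ) : Prop :=
  ContMDiff (𝓡 m) 𝓘(ℝ, ℂ) ∞ f ∧
    ∀ x₀ : S, ∀ z ∈ (extChartAt (𝓡 m) x₀).target,
      chartLaplacian G x₀ (f ∘ (extChartAt (𝓡 m) x₀).symm) z = h ((extChartAt (𝓡 m) x₀).symm z)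

variable [T2Space S] [CompactSpace S] [MeasurableSpace S]

/-- A smooth partition of unity on `S` subordinate to the domains of the charts. -/
def partitionOfUnity (m : ℕ) (S : Type*) [TopologicalSpace S]
    [ChartedSpace (EuclideanSpace ℝ (Fin m)) S] [IsManifold (𝓡 m) ∞ S] [T2Space S]
    [CompactSpace S] : SmoothPartitionOfUnity S (𝓡 m) S univ :=
  (SmoothPartitionOfUnity.exists_isSubordinate_chartAt_source (𝓡 m) S).choose

/-- The Riemannian volume measure: `∫ f = ∑ₓ ∫ (ρₓ f) √G dy`, the `x`-th integral being taken in the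
chart around `x`, with `(ρₓ)` a partition of unity subordinate to the charts. -/
def riemannianVolume (G : Metric m S) : Measure S :=
  Measure.sum fun x : S =>
    ((volume.restrict (extChartAt (𝓡 m) x).target).withDensity fun z =>
      ENNReal.ofReal
        (partitionOfUnity m S x ((extChartAt (𝓡 m) x).symm z) * volDensity G x z)).map
      (extChartAt (𝓡 m) x).symm

/-- `L²(S, ℂ)`. -/
abbrev L2Matter (G : Metric m S) := Lp ℂ 2 (riemannianVolume G)

/-- `a₀ = 2 n (n - 1) / α_M`. -/
def a0 (n : ℕ) (αM : ℝ) : ℝ := 2 * n * (n - 1) * αM⁻¹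

/-- `μ̄ = (4 / n²) a₀ μ - (m - 1)² / 4`. -/
def muBar (m n : ℕ) (αM μ : ℝ) : ℝ := 4 / (n : ℝ) ^ 2 * a0 n αM * μ - ((m : ℝ) - 1) ^ 2 / 4

/-- The space `𝓗₀ ⊆ L²(S, ℂ)` spanned by the eigenspaces of `-Δ` whose eigenvalues `μ`
satisfy `μ̄ ≤ 0`. -/
def H0 (G : Metric m S) (n : ℕ) (αM : ℝ) : Submodule ℂ (L2Matter G) :=
  Submodule.span ℂ {F | ∃ μ : ℝ, muBar m n αM μ ≤ 0 ∧
    ∃ f : S → ℂ, HasLaplacian G f (fun y => -((μ : ℂ) * f y)) ∧ F =ᵐ[riemannianVolume G] f}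

/-- `K = ΔF` for (the classes of) smooth functions in `L²(S, ℂ)`. -/
def IsLaplacianOf (G : Metric m S) (K F : L2Matter G) : Prop :=
  ∃ f h : S → ℂ, HasLaplacian G f h ∧
    F =ᵐ[riemannianVolume G] f ∧ K =ᵐ[riemannianVolume G] h

end Matter

/-! ### The radial variable -/

section Radial

/-- The measure `r^q dr` on `I`. -/
def radialMeasure (I : Set ℝ) (q : ℝ) : Measure ℝ :=
  (volume.restrict I).withDensity fun r => ENNReal.ofReal (r ^ q)

/-- `L²(I, q)`: the complex functions on `I` with `∫_I r^q |u|² < ∞`. -/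
abbrev L2Radial (I : Set ℝ) (q : ℝ) := Lp ℂ 2 (radialMeasure I q)

/-- `C_c^∞(I)` for an open set `I` of positive numbers, the functions being extended by zero
to all of `ℝ`. -/
def TestFn (I : Set ℝ) : Submodule ℂ (ℝ → ℂ) where
  carrier := {u | ContDiff ℝ ∞ u ∧ HasCompactSupport u ∧ tsupport u ⊆ I ∩ Ioi 0}
  add_mem' {u v} hu hv := ⟨hu.1.add hv.1, hu.2.1.add hv.2.1,
    (tsupport_add u v).trans (union_subset hu.2.2 hv.2.2)⟩
  zero_mem' := ⟨contDiff_const, HasCompactSupport.zero, by simp [tsupport]⟩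
  smul_mem' c u hu := ⟨contDiff_const.smul hu.1, hu.2.1.smul_left (f := fun _ => c),
    (tsupport_smul_subset_right (fun _ => c) u).trans hu.2.2⟩

theorem TestFn.differentiable {I : Set ℝ} (u : TestFn I) : Differentiable ℝ (u : ℝ → ℂ) :=
  u.2.1.differentiable (by simp)

/-- `u ↦ u̇` on `C_c^∞(I)`. -/
def TestFn.derivMap (I : Set ℝ) : TestFn I →ₗ[ℂ] TestFn I where
  toFun u := ⟨deriv (u : ℝ → ℂ), (contDiff_infty_iff_deriv.1 u.2.1).2, u.2.2.1.deriv,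
    (tsupport_deriv_subset (𝕜 := ℝ)).trans u.2.2.2⟩
  map_add' u v := by
    ext r
    exact deriv_add (TestFn.differentiable u r) (TestFn.differentiable v r)
  map_smul' c u := by
    ext r
    exact deriv_const_smul c (TestFn.differentiable u r)

theorem TestFn.contDiff_rpow_mul {I : Set ℝ} (u : TestFn I) (p : ℝ) :
    ContDiff ℝ ∞ fun r : ℝ => ((r ^ p : ℝ) : ℂ) * (u : ℝ → ℂ) r := by
  rw [contDiff_iff_contDiffAt]
  intro r
  by_cases hr : r ∈ tsupport (u : ℝ → ℂ)
  · have h0 : r ≠ 0 := ne_of_gt (u.2.2.2 hr).2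
    exact (Complex.ofRealCLM.contDiff.contDiffAt.comp r
      (Real.contDiffAt_rpow_const_of_ne h0)).mul u.2.1.contDiffAt
  · refine (contDiffAt_const (c := (0 : ℂ))).congr_of_eventuallyEq ?_
    filter_upwards [notMem_tsupport_iff_eventuallyEq.1 hr] with s hs
    simp [hs]

/-- `u ↦ r^p u` on `C_c^∞(I)`. -/
def TestFn.rpowMul (I : Set ℝ) (p : ℝ) : TestFn I →ₗ[ℂ] TestFn I where
  toFun u := ⟨fun r => ((r ^ p : ℝ) : ℂ) * (u : ℝ → ℂ) r, TestFn.contDiff_rpow_mul u p,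
    u.2.2.1.mul_left (f := fun r : ℝ => ((r ^ p : ℝ) : ℂ)),
    (tsupport_mul_subset_right (f := fun r : ℝ => ((r ^ p : ℝ) : ℂ))).trans u.2.2.2⟩
  map_add' u v := by
    ext r
    simp [mul_add]
  map_smul' c u := by
    ext r
    simp [mul_left_comm]

/-- `u ↦ r⁻¹ ∂_r (r ∂_r u)` on `C_c^∞(I)`. -/
def TestFn.radialKinetic (I : Set ℝ) : TestFn I →ₗ[ℂ] TestFn I :=
  TestFn.rpowMul I (-1) ∘ₗ TestFn.derivMap I ∘ₗ TestFn.rpowMul I 1 ∘ₗ TestFn.derivMap I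

theorem TestFn.memLp {I : Set ℝ} (u : TestFn I) : MemLp (u : ℝ → ℂ) 2 (radialMeasure I 1) := by
  have : IsLocallyFiniteMeasure (radialMeasure I 1) := by
    unfold radialMeasure
    simp only [Real.rpow_one]
    exact IsLocallyFiniteMeasure.withDensity_ofReal continuous_id
  exact u.2.1.continuous.memLp_of_hasCompactSupport u.2.2.1

/-- The embedding `C_c^∞(I) → L²(I, 1)`. -/
def TestFn.toL2 (I : Set ℝ) : TestFn I →ₗ[ℂ] L2Radial I 1 where
  toFun u := (TestFn.memLp u).toLp _
  map_add' u v := MemLp.toLp_add (TestFn.memLp u) (TestFn.memLp v)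
  map_smul' c u := MemLp.toLp_const_smul c (TestFn.memLp u)

end Radial

/-! ### Symmetric operators bounded above and their Friedrichs extensions -/

section Friedrichs

variable {E : Type*} [NormedAddCommGroup E] [InnerProductSpace ℂ E]

/-- `⟨Tφ, φ⟩ ≤ c ‖φ‖²` on the domain of `T`. -/
def BoundedAbove (T : E →ₗ.[ℂ] E) : Prop :=
  ∃ c : ℝ, ∀ φ : T.domain, (⟪T φ, (φ : E)⟫_ℂ).re ≤ c * ‖(φ : E)‖ ^ 2

/-- The quadratic form `⟨Tφ, φ⟩`. -/
def quadForm (T : E →ₗ.[ℂ] E) (φ : T.domain) : ℝ := (⟪T φ, (φ : E)⟫_ℂ).re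

/-- The sequence `φ k` in the domain of `T` converges to `ψ` and is a Cauchy sequence for the
energy form `⟨-Tφ, φ⟩`. -/
def FormConverges (T : E →ₗ.[ℂ] E) (φ : ℕ → T.domain) (ψ : E) : Prop :=
  Tendsto (fun k => (φ k : E)) atTop (𝓝 ψ) ∧
    Tendsto (fun p : ℕ × ℕ => quadForm T (φ p.1 - φ p.2)) atTop (𝓝 0)

theorem quadForm_parallelogram (T : E →ₗ.[ℂ] E) (a b : T.domain) :
    quadForm T (a + b) + quadForm T (a - b) = 2 * quadForm T a + 2 * quadForm T b := by
  simp only [quadForm, LinearPMap.map_add, LinearPMap.map_sub, Submodule.coe_add,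
    Submodule.coe_sub, inner_add_left, inner_add_right, inner_sub_left, inner_sub_right,
    Complex.add_re, Complex.sub_re]
  ring

theorem tendsto_sub_of_tendsto {E : Type*} [NormedAddCommGroup E] {φ : ℕ → E} {ψ : E} (h : Tendsto φ atTop (𝓝 ψ)) :
    Tendsto (fun p : ℕ × ℕ => φ p.1 - φ p.2) atTop (𝓝 0) := by
  rw [← prod_atTop_atTop_eq]
  simpa using (h.comp tendsto_fst).sub (h.comp tendsto_snd)

theorem FormConverges.add {T : E →ₗ.[ℂ] E} (hT : BoundedAbove T) {φ φ' : ℕ → T.domain}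
    {ψ ψ' : E} (h : FormConverges T φ ψ) (h' : FormConverges T φ' ψ') :
    FormConverges T (φ + φ') (ψ + ψ') := by
  obtain ⟨c, hc⟩ := hT
  refine ⟨by simpa using h.1.add h'.1, ?_⟩
  have e1 := tendsto_sub_of_tendsto h.1
  have e2 := tendsto_sub_of_tendsto h'.1
  have up : Tendsto (fun p : ℕ × ℕ => c * ‖((φ p.1 : E) - φ p.2) + ((φ' p.1 : E) - φ' p.2)‖ ^ 2)
      atTop (𝓝 0) := by
    simpa using ((e1.add e2).norm.pow 2).const_mul c
  have lo : Tendsto (fun p : ℕ × ℕ => 2 * quadForm T (φ p.1 - φ p.2)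
      + 2 * quadForm T (φ' p.1 - φ' p.2)
      - c * ‖((φ p.1 : E) - φ p.2) - ((φ' p.1 : E) - φ' p.2)‖ ^ 2) atTop (𝓝 0) := by
    simpa using ((h.2.const_mul 2).add (h'.2.const_mul 2)).sub
      (((e1.sub e2).norm.pow 2).const_mul c)
  refine tendsto_of_tendsto_of_tendsto_of_le_of_le lo up (fun p => ?_) (fun p => ?_)
  · have h1 := quadForm_parallelogram T (φ p.1 - φ p.2) (φ' p.1 - φ' p.2)
    have h2 := hc ((φ p.1 - φ p.2) - (φ' p.1 - φ' p.2))
    have h3 : (φ + φ') p.1 - (φ + φ') p.2 = (φ p.1 - φ p.2) + (φ' p.1 - φ' p.2) := by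
      simp only [Pi.add_apply]; abel
    simp only [h3]
    have h4 : quadForm T ((φ p.1 - φ p.2) - (φ' p.1 - φ' p.2)) ≤
        c * ‖((φ p.1 : E) - φ p.2) - ((φ' p.1 : E) - φ' p.2)‖ ^ 2 := h2
    linarith
  · have h2 := hc ((φ p.1 - φ p.2) + (φ' p.1 - φ' p.2))
    have h3 : (φ + φ') p.1 - (φ + φ') p.2 = (φ p.1 - φ p.2) + (φ' p.1 - φ' p.2) := by
      simp only [Pi.add_apply]; abel
    simp only [h3]
    simpa [quadForm] using h2

theorem FormConverges.smul {T : E →ₗ.[ℂ] E} (z : ℂ) {φ : ℕ → T.domain} {ψ : E}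
    (h : FormConverges T φ ψ) : FormConverges T (z • φ) (z • ψ) := by
  refine ⟨by simpa using h.1.const_smul z, ?_⟩
  have key : ∀ p : ℕ × ℕ, quadForm T ((z • φ) p.1 - (z • φ) p.2)
      = Complex.normSq z * quadForm T (φ p.1 - φ p.2) := by
    intro p
    have h3 : (z • φ) p.1 - (z • φ) p.2 = z • (φ p.1 - φ p.2) := by
      simp only [Pi.smul_apply, smul_sub]
    rw [h3, quadForm, quadForm, LinearPMap.map_smul, Submodule.coe_smul, inner_smul_left,
      inner_smul_right, ← mul_assoc, mul_comm ((starRingEnd ℂ) z) z, Complex.mul_conj,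
      Complex.re_ofReal_mul]
  simp only [key]
  simpa using h.2.const_mul (Complex.normSq z)

/-- The form domain (energy space) of an operator bounded above: the completion of its domain with
respect to the norm `⟨-Tφ, φ⟩ + (c + 1) ‖φ‖²`, realized as a subspace of `E`. -/
def formDomain (T : E →ₗ.[ℂ] E) (hT : BoundedAbove T) : Submodule ℂ E where
  carrier := {ψ | ∃ φ : ℕ → T.domain, FormConverges T φ ψ}
  add_mem' := fun ⟨_, h⟩ ⟨_, h'⟩ => ⟨_, h.add hT h'⟩
  zero_mem' := ⟨fun _ => 0, by simp [FormConverges, quadForm]⟩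
  smul_mem' := fun z _ ⟨_, h⟩ => ⟨_, h.smul z⟩

/-- The Friedrichs extension of a densely defined symmetric operator `T` that is bounded above:
its domain consists of the `ψ` in the form domain for which there is `χ ∈ E` with
`⟨ψ, Tφ⟩ = ⟨χ, φ⟩` for all `φ` in the domain of `T` ("`Tψ ∈ E` in the distributional sense"),
and it maps such a `ψ` to `χ`. -/
def friedrichs [CompleteSpace E] (T : E →ₗ.[ℂ] E) (hT : BoundedAbove T) : E →ₗ.[ℂ] E :=
  T.adjoint.domRestrict (formDomain T hT)

/-- The linear relation `Γ` is (the graph of) a densely defined symmetric operator that is bounded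
above, and the Friedrichs extension of this operator extends it and is selfadjoint. -/
def IsSelfAdjointInFriedrichsSense [CompleteSpace E] (Γ : Submodule ℂ (E × E)) : Prop :=
  ∃ T : E →ₗ.[ℂ] E, T.graph = Γ ∧ Dense (T.domain : Set E) ∧ T.IsFormalAdjoint T ∧
    ∃ hT : BoundedAbove T, T ≤ friedrichs T hT ∧ IsSelfAdjoint (friedrichs T hT)

end Friedrichs

/-! ### The Hamilton operator -/

section Hamiltonian

/-- `V̄ = α_M V / (n (n - 1))`. -/
def VBar (n : ℕ) (αM V : ℝ) : ℝ := αM / (n * (n - 1)) * V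

/-- `Λ̄ = 2 Λ / (n (n - 1))`. -/
def LambdaBar (n : ℕ) (Λ : ℝ) : ℝ := 2 / (n * (n - 1)) * Λ

variable {m : ℕ} {S : Type*} [TopologicalSpace S] [ChartedSpace (EuclideanSpace ℝ (Fin m)) S]
  [IsManifold (𝓡 m) ∞ S] [T2Space S] [CompactSpace S] [MeasurableSpace S]

/-- The Hilbert space tensor product `L²(I, 1) ⊗ 𝓗₀`. -/
abbrev StateSpace (G : Metric m S) (n : ℕ) (αM : ℝ) (I : Set ℝ) :=
  UniformSpace.Completion (L2Radial I 1 ⊗[ℂ] H0 G n αM)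

/-- The wave function `ψ(r, y) = u(r) F(y)`, with `u ∈ C_c^∞(I)` and `F ∈ 𝓗₀`, as an element of
`L²(I, 1) ⊗ 𝓗₀`. -/
def wave {G : Metric m S} {n : ℕ} {αM : ℝ} {I : Set ℝ} (u : TestFn I) (F : H0 G n αM) :
    StateSpace G n αM I :=
  ((TestFn.toL2 I u ⊗ₜ[ℂ] F : L2Radial I 1 ⊗[ℂ] H0 G n αM) : StateSpace G n αM I)

/-- The graph of the Hamilton operator
`Hψ = r⁻¹ ∂_r (r ∂_r ψ) + r⁻² (-(4/n²) a₀ Δψ - ((m-1)²/4) ψ) + (16/n²) (V̄ + Λ̄) r² ψ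
  - (16/n²) κ r^{2(n-2)/n} ψ`
on `C_c^∞(I) ⊗ 𝓗₀`: the pairs `(ψ, Hψ)` with `ψ = u F`, and their linear combinations. -/
def hamiltonianGraph (G : Metric m S) (n : ℕ) (αM V Λ κ : ℝ) (I : Set ℝ) :
    Submodule ℂ (StateSpace G n αM I × StateSpace G n αM I) :=
  Submodule.span ℂ {p | ∃ (u : TestFn I) (F K : H0 G n αM),
    IsLaplacianOf G (K : L2Matter G) (F : L2Matter G) ∧
    p.1 = wave u F ∧
    p.2 = wave (TestFn.radialKinetic I u) F
      + wave (TestFn.rpowMul I (-2) u)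
          (-((4 / (n : ℂ) ^ 2 * (a0 n αM : ℂ)) • K) - (((m : ℂ) - 1) ^ 2 / 4) • F)
      + (16 / (n : ℂ) ^ 2 * ((VBar n αM V + LambdaBar n Λ : ℝ) : ℂ)) •
          wave (TestFn.rpowMul I 2 u) F
      - (16 / (n : ℂ) ^ 2 * (κ : ℂ)) • wave (TestFn.rpowMul I (2 * ((n : ℝ) - 2) / n) u) F}

/-- The Hamilton operator is selfadjoint in `L²(I, 1) ⊗ 𝓗₀`, its domain of definition being that of
the Friedrichs extension. -/
def HamiltonianSelfAdjoint (G : Metric m S) (n : ℕ) (αM V Λ κ : ℝ) (I : Set ℝ) : Prop :=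
  IsSelfAdjointInFriedrichsSense (E := StateSpace G n αM I) (hamiltonianGraph G n αM V Λ κ I)

end Hamiltonian

end

end FriedmanQC

/-!
Suppose the form of a densely defined operator `T` is `c ‖ψ‖²` minus a form of squares `‖dψ‖²`.
The completion of the domain in the energy norm `‖ψ‖² + ‖dψ‖²` maps injectively into the Hilbert
space, and the Riesz representation theorem there makes the Friedrichs extension selfadjoint.

On `u ⊗ F`, where `F` is an eigenvector of `-Δ` with eigenvalue `μ`, the operator `H` acts on `u`
as the radial operator with the extra term `-μ̄ r⁻²` in its form. Since `μ̄ ≤ 0` on `𝓗₀`, this term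
is minus a square, while the kinetic term is minus the square of `u'`, and the remaining potential
`A r² - B r^p`, with `0 ≤ p < 2`, only has to be bounded above on `I`. Eigenvectors for different
eigenvalues do not interact, because `Δ` is symmetric by Green's formula.
-/

namespace FriedmanQC

/-! ### Friedrichs extensions -/

section Friedrichs

universe u v

variable {E : Type u} [NormedAddCommGroup E] [InnerProductSpace ℂ E]

theorem re_inner_smul_sub_self (T : E →ₗ.[ℂ] E) (a : ℝ) (φ : T.domain) :
    (⟪(a : ℂ) • (φ : E) - T φ, (φ : E)⟫_ℂ).re = a * ‖(φ : E)‖ ^ 2 - quadForm T φ := by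
  rw [inner_sub_left, inner_smul_left, Complex.conj_ofReal, Complex.sub_re,
    Complex.re_ofReal_mul, ← RCLike.re_eq_complex_re, inner_self_eq_norm_sq, quadForm,
    RCLike.re_eq_complex_re]

theorem norm_sq_le_re_inner {T : E →ₗ.[ℂ] E} {c : ℝ}
    (hc : ∀ φ, quadForm T φ ≤ c * ‖(φ : E)‖ ^ 2) (φ : T.domain) :
    ‖(φ : E)‖ ^ 2 ≤ (⟪((c + 1 : ℝ) : ℂ) • (φ : E) - T φ, (φ : E)⟫_ℂ).re := by
  rw [re_inner_smul_sub_self]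
  linarith [hc φ]

/-- The energy inner product `(c + 1)⟪φ, χ⟫ - ⟪Tφ, χ⟫` on the domain of a symmetric operator `T`
bounded above by `c`. -/
noncomputable abbrev energyCore {T : E →ₗ.[ℂ] E} (hsym : T.IsFormalAdjoint T) {c : ℝ}
    (hc : ∀ φ, quadForm T φ ≤ c * ‖(φ : E)‖ ^ 2) : InnerProductSpace.Core ℂ T.domain where
  inner φ χ := ⟪((c + 1 : ℝ) : ℂ) • (φ : E) - T φ, (χ : E)⟫_ℂ
  conj_inner_symm φ χ := by
    simp only [inner_sub_left, inner_smul_left, map_sub, map_mul, Complex.conj_ofReal,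
      inner_conj_symm]
    rw [hsym φ χ]
  re_inner_nonneg φ := (sq_nonneg _).trans (norm_sq_le_re_inner hc φ)
  add_left φ φ' χ := by
    rw [← inner_add_left, LinearPMap.map_add, Submodule.coe_add, smul_add, add_sub_add_comm]
  smul_left φ χ r := by
    rw [← inner_smul_left, LinearPMap.map_smul, Submodule.coe_smul, smul_sub, smul_comm]
  definite φ h := by
    have hle := norm_sq_le_re_inner hc φ
    rw [h, Complex.zero_re] at hle
    simpa using hle.antisymm (sq_nonneg _)

/-- `H` is an energy space of `T`: a Hilbert space in which `e` embeds the domain of `T` densely,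
with inner product `a⟪φ, χ⟫ - ⟪Tφ, χ⟫`, and on which the inclusion of the domain into `E` extends
to a continuous map `ι`. -/
structure IsEnergySpace {H : Type*} [NormedAddCommGroup H] [InnerProductSpace ℂ H]
    (T : E →ₗ.[ℂ] E) (a : ℝ) (e : T.domain →ₗ[ℂ] H) (ι : H →L[ℂ] E) : Prop where
  denseRange : DenseRange e
  map_eq (φ : T.domain) : ι (e φ) = φ
  inner_eq (φ χ : T.domain) : ⟪e φ, e χ⟫_ℂ = ⟪(a : ℂ) • (φ : E) - T φ, (χ : E)⟫_ℂ

theorem exists_completion_of_core [CompleteSpace E] {D : Type v} [AddCommGroup D] [Module ℂ D]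
    (core : InnerProductSpace.Core ℂ D) (j : D →ₗ[ℂ] E)
    (hj : ∀ x, ‖j x‖ ^ 2 ≤ (core.inner x x).re) :
    ∃ (H : Type v) (_ : NormedAddCommGroup H) (_ : InnerProductSpace ℂ H) (_ : CompleteSpace H)
      (e : D →ₗ[ℂ] H) (ι : H →L[ℂ] E), DenseRange e ∧ (∀ x, ι (e x) = j x) ∧
        ∀ x y, ⟪e x, e y⟫_ℂ = core.inner x y := by
  let _ : NormedAddCommGroup D := core.toNormedAddCommGroup
  let _ : InnerProductSpace ℂ D := InnerProductSpace.ofCore core.toCore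
  have hbound : ∀ x, ‖j x‖ ≤ 1 * ‖x‖ := fun x => by
    have hx : ‖x‖ ^ 2 = (core.inner x x).re := norm_sq_eq_re_inner (𝕜 := ℂ) x
    rw [one_mul]
    exact le_of_sq_le_sq (hx ▸ hj x) (norm_nonneg _)
  let j' : D →L[ℂ] E := j.mkContinuous 1 hbound
  let e : D →L[ℂ] UniformSpace.Completion D := UniformSpace.Completion.toComplL
  have he : DenseRange e := UniformSpace.Completion.denseRange_coe
  have hu : IsUniformInducing e := UniformSpace.Completion.isUniformInducing_coe D
  exact ⟨UniformSpace.Completion D, inferInstance, inferInstance, inferInstance,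
    (e : D →ₗ[ℂ] UniformSpace.Completion D), j'.extend e, he,
    fun x => ContinuousLinearMap.extend_eq j' he hu x,
    fun x y => UniformSpace.Completion.inner_coe x y⟩

theorem exists_isEnergySpace [CompleteSpace E] {T : E →ₗ.[ℂ] E} (hsym : T.IsFormalAdjoint T)
    {c : ℝ} (hc : ∀ φ, quadForm T φ ≤ c * ‖(φ : E)‖ ^ 2) :
    ∃ (H : Type u) (_ : NormedAddCommGroup H) (_ : InnerProductSpace ℂ H) (_ : CompleteSpace H)
      (e : T.domain →ₗ[ℂ] H) (ι : H →L[ℂ] E), IsEnergySpace T (c + 1) e ι := by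
  obtain ⟨H, i₁, i₂, i₃, e, ι, he, hι, hinner⟩ :=
    exists_completion_of_core (energyCore hsym hc) T.domain.subtype (norm_sq_le_re_inner hc)
  exact ⟨H, i₁, i₂, i₃, e, ι, he, hι, hinner⟩

namespace IsEnergySpace

variable {H : Type*} [NormedAddCommGroup H] [InnerProductSpace ℂ H]
  {T : E →ₗ.[ℂ] E} {a : ℝ} {e : T.domain →ₗ[ℂ] H} {ι : H →L[ℂ] E}

theorem norm_sq (he : IsEnergySpace T a e ι) (φ : T.domain) :
    ‖e φ‖ ^ 2 = a * ‖(φ : E)‖ ^ 2 - quadForm T φ := by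
  rw [← re_inner_smul_sub_self, ← he.inner_eq]
  exact norm_sq_eq_re_inner (𝕜 := ℂ) (e φ)

theorem formConverges_iff (he : IsEnergySpace T a e ι) {φ : ℕ → T.domain} {ψ : E} :
    FormConverges T φ ψ ↔
      Tendsto (fun k => (φ k : E)) atTop (𝓝 ψ) ∧ CauchySeq fun k => e (φ k) := by
  refine and_congr_right fun hφ => ?_
  have hlim : Tendsto (fun p : ℕ × ℕ => a * ‖(φ p.1 : E) - φ p.2‖ ^ 2) atTop (𝓝 0) := by
    simpa using ((tendsto_sub_of_tendsto hφ).norm.pow 2).const_mul a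
  have hsq : ∀ p : ℕ × ℕ, ‖e (φ p.1) - e (φ p.2)‖ ^ 2
      = a * ‖(φ p.1 : E) - φ p.2‖ ^ 2 - quadForm T (φ p.1 - φ p.2) := fun p => by
    rw [← map_sub, he.norm_sq, Submodule.coe_sub]
  simp only [cauchySeq_iff_tendsto_dist_atTop_0, dist_eq_norm]
  constructor
  · intro h
    have hsub := hlim.sub h
    simp only [← hsq, sub_zero] at hsub
    simpa [Real.sqrt_sq (norm_nonneg _)] using hsub.sqrt
  · intro h
    simpa [hsq] using hlim.sub (h.pow 2)

theorem mem_formDomain_iff [CompleteSpace H] (he : IsEnergySpace T a e ι) (hT : BoundedAbove T)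
    {ψ : E} : ψ ∈ formDomain T hT ↔ ∃ h, ι h = ψ := by
  constructor
  · rintro ⟨φ, hφ⟩
    obtain ⟨hlim, hcauchy⟩ := he.formConverges_iff.1 hφ
    obtain ⟨h, hh⟩ := cauchySeq_tendsto_of_complete hcauchy
    refine ⟨h, tendsto_nhds_unique ((ι.continuous.tendsto h).comp hh) ?_⟩
    simpa only [Function.comp_def, he.map_eq] using hlim
  · rintro ⟨h, rfl⟩
    obtain ⟨y, hy, hlim⟩ := mem_closure_iff_seq_limit.1 (he.denseRange h)
    choose φ hφ using hy
    obtain rfl : (fun k => e (φ k)) = y := funext hφ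
    refine ⟨φ, he.formConverges_iff.2 ⟨?_, hlim.cauchySeq⟩⟩
    simpa only [Function.comp_def, he.map_eq] using (ι.continuous.tendsto h).comp hlim

theorem inner_apply (he : IsEnergySpace T a e ι) (hsym : T.IsFormalAdjoint T) (h : H)
    (φ : T.domain) : ⟪h, e φ⟫_ℂ = ⟪ι h, (a : ℂ) • (φ : E) - T φ⟫_ℂ := by
  induction h using he.denseRange.induction_on with
  | hp => exact isClosed_eq (by fun_prop) (by fun_prop)
  | ih χ =>
    rw [he.inner_eq, he.map_eq, inner_sub_left, inner_sub_right, inner_smul_left,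
      inner_smul_right, hsym χ φ, Complex.conj_ofReal]

end IsEnergySpace

variable [CompleteSpace E] {T : E →ₗ.[ℂ] E} {hT : BoundedAbove T}

theorem friedrichs_apply (ψ : (friedrichs T hT).domain) :
    friedrichs T hT ψ = T.adjoint ⟨ψ, ψ.2.2⟩ :=
  LinearPMap.domRestrict_apply rfl

theorem inner_friedrichs (hd : Dense (T.domain : Set E)) (ψ : (friedrichs T hT).domain)
    (φ : T.domain) : ⟪friedrichs T hT ψ, (φ : E)⟫_ℂ = ⟪(ψ : E), T φ⟫_ℂ := by
  rw [friedrichs_apply]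
  exact LinearPMap.adjoint_isFormalAdjoint hd _ φ

theorem exists_friedrichs_eq (hd : Dense (T.domain : Set E)) {ψ χ : E}
    (hψ : ψ ∈ formDomain T hT) (hχ : ∀ φ : T.domain, ⟪χ, (φ : E)⟫_ℂ = ⟪ψ, T φ⟫_ℂ) :
    ∃ ψ' : (friedrichs T hT).domain, (ψ' : E) = ψ ∧ friedrichs T hT ψ' = χ :=
  ⟨⟨ψ, hψ, LinearPMap.mem_adjoint_domain_of_exists _ ⟨χ, hχ⟩⟩, rfl,
    hd.eq_of_inner_left ℂ fun φ hφ =>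
      (inner_friedrichs hd _ ⟨φ, hφ⟩).trans (hχ ⟨φ, hφ⟩).symm⟩

theorem le_friedrichs (hd : Dense (T.domain : Set E)) (hsym : T.IsFormalAdjoint T) :
    T ≤ friedrichs T hT := by
  have hle : T ≤ T.adjoint := LinearPMap.IsFormalAdjoint.le_adjoint hd hsym
  refine ⟨fun φ hφ => ⟨⟨fun _ => ⟨φ, hφ⟩, by simp [FormConverges, quadForm]⟩, hle.1 hφ⟩,
    fun φ ψ hφψ => ?_⟩
  rw [friedrichs_apply]
  exact hle.2 hφψ

theorem isSelfAdjoint_of_surjective {A : E →ₗ.[ℂ] E} (hd : Dense (A.domain : Set E))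
    (hsym : A.IsFormalAdjoint A) (a : ℝ)
    (hsurj : ∀ x : E, ∃ ψ : A.domain, (a : ℂ) • (ψ : E) - A ψ = x) : IsSelfAdjoint A := by
  rw [LinearPMap.isSelfAdjoint_def]
  have hle : A ≤ A.adjoint := LinearPMap.IsFormalAdjoint.le_adjoint hd hsym
  refine (LinearPMap.eq_of_le_of_domain_eq hle (le_antisymm hle.1 fun ψ hψ => ?_)).symm
  obtain ⟨ψ₀, hψ₀⟩ := hsurj ((a : ℂ) • ψ - A.adjoint ⟨ψ, hψ⟩)
  obtain ⟨φ, hφ⟩ := hsurj (ψ - ψ₀)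
  have hadj : ⟪A.adjoint ⟨ψ, hψ⟩, (φ : E)⟫_ℂ = ⟪ψ, A φ⟫_ℂ :=
    LinearPMap.adjoint_isFormalAdjoint hd _ _
  have heq := congrArg (fun x => ⟪x, (φ : E)⟫_ℂ) hψ₀
  have hnorm : ⟪ψ - ψ₀, (a : ℂ) • (φ : E) - A φ⟫_ℂ = 0 := by
    simp only [inner_sub_left, inner_smul_left, Complex.conj_ofReal, hadj, hsym ψ₀ φ] at heq
    simp only [inner_sub_left, inner_sub_right, inner_smul_right]
    linear_combination -heq
  rw [hφ, inner_self_eq_zero, sub_eq_zero] at hnorm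
  exact hnorm ▸ ψ₀.2

namespace IsEnergySpace

variable {H : Type*} [NormedAddCommGroup H] [InnerProductSpace ℂ H]
  {a : ℝ} {e : T.domain →ₗ[ℂ] H} {ι : H →L[ℂ] E}

theorem inner_smul_sub_friedrichs (he : IsEnergySpace T a e ι) (hd : Dense (T.domain : Set E))
    (hsym : T.IsFormalAdjoint T) {ψ : (friedrichs T hT).domain} {h : H} (hψ : ι h = ψ) (h' : H) :
    ⟪(a : ℂ) • (ψ : E) - friedrichs T hT ψ, ι h'⟫_ℂ = ⟪h, h'⟫_ℂ := by
  induction h' using he.denseRange.induction_on with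
  | hp => exact isClosed_eq (by fun_prop) (by fun_prop)
  | ih φ =>
    rw [he.inner_apply hsym, he.map_eq, hψ, inner_sub_left, inner_sub_right, inner_smul_left,
      inner_smul_right, inner_friedrichs hd, Complex.conj_ofReal]

theorem isFormalAdjoint_friedrichs [CompleteSpace H] (he : IsEnergySpace T a e ι)
    (hd : Dense (T.domain : Set E)) (hsym : T.IsFormalAdjoint T) :
    (friedrichs T hT).IsFormalAdjoint (friedrichs T hT) := by
  intro ψ ψ'
  obtain ⟨h, hh⟩ := (he.mem_formDomain_iff hT).1 ψ.2.1
  obtain ⟨h', hh'⟩ := (he.mem_formDomain_iff hT).1 ψ'.2.1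
  have hinner := he.inner_smul_sub_friedrichs hd hsym hh h'
  have hinner' := he.inner_smul_sub_friedrichs hd hsym hh' h
  rw [← inner_conj_symm h h', ← hinner', inner_conj_symm, hh, hh', inner_sub_left,
    inner_sub_right, inner_smul_left, inner_smul_right, Complex.conj_ofReal] at hinner
  linear_combination -hinner

theorem exists_smul_sub_friedrichs_eq [CompleteSpace H] (he : IsEnergySpace T a e ι)
    (hd : Dense (T.domain : Set E)) (hsym : T.IsFormalAdjoint T) (x : E) :
    ∃ ψ : (friedrichs T hT).domain, (a : ℂ) • (ψ : E) - friedrichs T hT ψ = x := by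
  -- Riesz: `h` represents the functional `⟪x, ι ·⟫` in the energy inner product.
  set h := ι.adjoint x
  have hweak : ∀ φ : T.domain, ⟪(a : ℂ) • ι h - x, (φ : E)⟫_ℂ = ⟪ι h, T φ⟫_ℂ := fun φ => by
    have hφ := he.inner_apply hsym h φ
    rw [ContinuousLinearMap.adjoint_inner_left, he.map_eq, inner_sub_right,
      inner_smul_right] at hφ
    rw [inner_sub_left, inner_smul_left, Complex.conj_ofReal, hφ, sub_sub_cancel]
  obtain ⟨ψ, hψ, hAψ⟩ := exists_friedrichs_eq hd ((he.mem_formDomain_iff hT).2 ⟨h, rfl⟩) hweak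
  exact ⟨ψ, by rw [hAψ, hψ, sub_sub_cancel]⟩

end IsEnergySpace

theorem isSelfAdjoint_friedrichs (hd : Dense (T.domain : Set E)) (hsym : T.IsFormalAdjoint T) :
    IsSelfAdjoint (friedrichs T hT) := by
  obtain ⟨c, hc⟩ := id hT
  obtain ⟨H, _, _, _, e, ι, he⟩ := exists_isEnergySpace hsym hc
  exact isSelfAdjoint_of_surjective (hd.mono (le_friedrichs hd hsym).1)
    (he.isFormalAdjoint_friedrichs hd hsym) (c + 1) (he.exists_smul_sub_friedrichs_eq hd hsym)

theorem isSelfAdjointInFriedrichsSense {Γ : Submodule ℂ (E × E)}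
    (hd : Dense (Prod.fst '' (Γ : Set (E × E))))
    (hsym : ∀ p ∈ Γ, ∀ q ∈ Γ, ⟪p.2, q.1⟫_ℂ = ⟪p.1, q.2⟫_ℂ)
    (hb : ∃ c : ℝ, ∀ p ∈ Γ, (⟪p.2, p.1⟫_ℂ).re ≤ c * ‖p.1‖ ^ 2) :
    IsSelfAdjointInFriedrichsSense Γ := by
  have hsingle : ∀ p ∈ Γ, p.1 = 0 → p.2 = 0 := fun p hp hp₁ => by
    refine hd.eq_zero_of_inner_left ℂ ?_
    rintro _ ⟨q, hq, rfl⟩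
    exact (hsym p hp q hq).trans (by rw [hp₁, inner_zero_left])
  have hgraph : ∀ x : Γ.toLinearPMap.domain, ((x : E), Γ.toLinearPMap x) ∈ Γ :=
    Submodule.mem_graph_toLinearPMap hsingle
  have hd' : Dense (Γ.toLinearPMap.domain : Set E) := by
    simpa [Submodule.toLinearPMap_domain] using hd
  have hsym' : Γ.toLinearPMap.IsFormalAdjoint Γ.toLinearPMap :=
    fun x y => hsym _ (hgraph x) _ (hgraph y)
  exact ⟨Γ.toLinearPMap, Submodule.toLinearPMap_graph_eq Γ hsingle, hd', hsym',
    hb.imp fun c h φ => h _ (hgraph φ), le_friedrichs hd' hsym',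
    isSelfAdjoint_friedrichs hd' hsym'⟩

end Friedrichs

/-! ### Operators on a tensor product -/

section Span

variable {ι E Z : Type*} [NormedAddCommGroup E] [InnerProductSpace ℂ E] [NormedAddCommGroup Z]
  [InnerProductSpace ℂ Z] {a b : ι → E} {d : ι → Z} {c : ℝ}

theorem inner_linearCombination_eq
    (h : ∀ i j, ⟪b i, a j⟫_ℂ = c * ⟪a i, a j⟫_ℂ - ⟪d i, d j⟫_ℂ) (x y : ι →₀ ℂ) :
    ⟪Finsupp.linearCombination ℂ b x, Finsupp.linearCombination ℂ a y⟫_ℂ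
      = c * ⟪Finsupp.linearCombination ℂ a x, Finsupp.linearCombination ℂ a y⟫_ℂ
        - ⟪Finsupp.linearCombination ℂ d x, Finsupp.linearCombination ℂ d y⟫_ℂ := by
  induction x using Finsupp.induction_linear with
  | zero => simp
  | add x x' hx hx' =>
    simp only [map_add, inner_add_left, hx, hx']
    ring
  | single i s =>
    induction y using Finsupp.induction_linear with
    | zero => simp
    | add y y' hy hy' =>
      simp only [map_add, inner_add_right, hy, hy']
      ring
    | single j t =>
      simp only [Finsupp.linearCombination_single, inner_smul_left, inner_smul_right, h]
      ring

theorem exists_linearCombination_of_mem_span {p : E × E}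
    (hp : p ∈ Submodule.span ℂ (range fun i => (a i, b i))) :
    ∃ x : ι →₀ ℂ, p = (Finsupp.linearCombination ℂ a x, Finsupp.linearCombination ℂ b x) := by
  obtain ⟨x, rfl⟩ := Finsupp.mem_span_range_iff_exists_finsupp.1 hp
  exact ⟨x, Prod.ext (by simp [Finsupp.linearCombination_apply, Finsupp.sum, Prod.fst_sum])
    (by simp [Finsupp.linearCombination_apply, Finsupp.sum, Prod.snd_sum])⟩

theorem isSelfAdjointInFriedrichsSense_span [CompleteSpace E]
    (h : ∀ i j, ⟪b i, a j⟫_ℂ = c * ⟪a i, a j⟫_ℂ - ⟪d i, d j⟫_ℂ)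
    (hd : Dense (Submodule.span ℂ (range a) : Set E)) :
    IsSelfAdjointInFriedrichsSense (Submodule.span ℂ (range fun i => (a i, b i))) := by
  have hkey := inner_linearCombination_eq h
  refine isSelfAdjointInFriedrichsSense (hd.mono ?_) (fun p hp q hq => ?_) ⟨c, fun p hp => ?_⟩
  · change (Submodule.span ℂ (range a) : Set E)
      ⊆ (Submodule.span ℂ (range fun i => (a i, b i))).map (LinearMap.fst ℂ E E)
    rw [Submodule.map_span, ← range_comp]
    rfl
  · obtain ⟨x, rfl⟩ := exists_linearCombination_of_mem_span hp
    obtain ⟨y, rfl⟩ := exists_linearCombination_of_mem_span hq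
    rw [← inner_conj_symm (Finsupp.linearCombination ℂ a x), hkey x y, hkey y x]
    simp only [map_sub, map_mul, Complex.conj_ofReal, inner_conj_symm]
  · obtain ⟨x, rfl⟩ := exists_linearCombination_of_mem_span hp
    rw [hkey x x, Complex.sub_re, Complex.re_ofReal_mul, ← RCLike.re_eq_complex_re,
      inner_self_eq_norm_sq, inner_self_eq_norm_sq]
    exact sub_le_self _ (sq_nonneg ‖Finsupp.linearCombination ℂ d x‖)

end Span

section TensorProduct

variable {X Y : Type*} [NormedAddCommGroup X] [InnerProductSpace ℂ X] [NormedAddCommGroup Y]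
  [InnerProductSpace ℂ Y]

/-- The bilinear map `(x, y) ↦ x ⊗ y` to the Hilbert space tensor product. -/
noncomputable def pureTensor : X →ₗ[ℂ] Y →ₗ[ℂ] UniformSpace.Completion (X ⊗[ℂ] Y) :=
  (TensorProduct.mk ℂ X Y).compr₂ (UniformSpace.Completion.toComplₗᵢ (𝕜 := ℂ)).toLinearMap

theorem inner_pureTensor (x x' : X) (y y' : Y) :
    ⟪pureTensor x y, pureTensor x' y'⟫_ℂ = ⟪x, x'⟫_ℂ * ⟪y, y'⟫_ℂ :=
  (UniformSpace.Completion.inner_coe _ _).trans (TensorProduct.inner_tmul ..)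

theorem continuous_pureTensor_left (y : Y) : Continuous fun x : X => pureTensor x y :=
  (UniformSpace.Completion.continuous_coe _).comp
    (TensorProduct.continuous_tmul.comp (by fun_prop : Continuous fun x : X => (x, y)))

theorem dense_of_forall_pureTensor_mem {V : Submodule ℂ (UniformSpace.Completion (X ⊗[ℂ] Y))}
    (hV : ∀ x y, pureTensor x y ∈ V) : Dense (V : Set (UniformSpace.Completion (X ⊗[ℂ] Y))) := by
  refine UniformSpace.Completion.denseRange_coe.mono ?_
  rintro _ ⟨t, rfl⟩
  induction t with
  | zero => exact V.zero_mem
  | tmul x y => exact hV x y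
  | add s t hs ht =>
    rw [UniformSpace.Completion.coe_add]
    exact V.add_mem hs ht

theorem dense_of_pureTensor_mem {ι : Type*} {j : ι → X} (hj : DenseRange j) {s : Set Y}
    (hs : Submodule.span ℂ s = ⊤) {V : Submodule ℂ (UniformSpace.Completion (X ⊗[ℂ] Y))}
    (hV : ∀ i, ∀ y ∈ s, pureTensor (j i) y ∈ V) :
    Dense (V : Set (UniformSpace.Completion (X ⊗[ℂ] Y))) := by
  have hspan : ∀ i y, pureTensor (j i) y ∈ V := fun i y => by
    have hle : Submodule.span ℂ s ≤ V.comap (pureTensor (j i)) := Submodule.span_le.2 (hV i)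
    exact hle (hs ▸ Submodule.mem_top)
  have hclosure : Dense (V.topologicalClosure : Set (UniformSpace.Completion (X ⊗[ℂ] Y))) :=
    dense_of_forall_pureTensor_mem fun x y => hj.induction_on
      (p := fun x => pureTensor x y ∈ V.topologicalClosure) x
      (V.isClosed_topologicalClosure.preimage (continuous_pureTensor_left y))
      fun i => V.le_topologicalClosure (hspan i y)
  rwa [Submodule.topologicalClosure_coe, dense_closure] at hclosure

end TensorProduct

section SymmetricRelation

variable {Y : Type*} [NormedAddCommGroup Y] [InnerProductSpace ℂ Y]

theorem inner_eq_of_mem_span {D : Set (Y × Y)} {p : Y × Y}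
    (hp : ∀ q ∈ D, ⟪p.2, q.1⟫_ℂ = ⟪p.1, q.2⟫_ℂ) {q : Y × Y} (hq : q ∈ Submodule.span ℂ D) :
    ⟪p.2, q.1⟫_ℂ = ⟪p.1, q.2⟫_ℂ := by
  induction hq using Submodule.span_induction with
  | mem q hq => exact hp q hq
  | zero => simp
  | add q q' _ _ hq hq' => simp [hq, hq']
  | smul r q _ hq => simp [hq]

-- An everywhere defined symmetric operator has no proper symmetric extension.
theorem mem_span_of_symmetric {D : Set (Y × Y)} (hspan : Submodule.span ℂ (Prod.fst '' D) = ⊤)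
    (hD : ∀ p ∈ D, ∀ q ∈ D, ⟪p.2, q.1⟫_ℂ = ⟪p.1, q.2⟫_ℂ) {p : Y × Y}
    (hp : ∀ q ∈ D, ⟪p.2, q.1⟫_ℂ = ⟪p.1, q.2⟫_ℂ) : p ∈ Submodule.span ℂ D := by
  have hmem : p.1 ∈ (Submodule.span ℂ D).map (LinearMap.fst ℂ Y Y) := by
    rw [Submodule.map_span]
    exact hspan.ge Submodule.mem_top
  obtain ⟨p', hp', hfst⟩ := hmem
  replace hfst : p'.1 = p.1 := hfst
  have hle : Submodule.span ℂ (Prod.fst '' D) ≤ LinearMap.ker (innerₛₗ ℂ (p.2 - p'.2)) := by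
    rw [Submodule.span_le]
    rintro _ ⟨q, hq, rfl⟩
    have hq' : ⟪q.2, p'.1⟫_ℂ = ⟪q.1, p'.2⟫_ℂ := inner_eq_of_mem_span (hD q hq) hp'
    change ⟪p.2 - p'.2, q.1⟫_ℂ = 0
    rw [inner_sub_left, hp q hq, ← inner_conj_symm p'.2, ← hq', inner_conj_symm, hfst, sub_self]
  have hsnd : ⟪p.2 - p'.2, p.2 - p'.2⟫_ℂ = 0 := hle (hspan.ge Submodule.mem_top)
  rw [inner_self_eq_zero, sub_eq_zero] at hsnd
  exact Prod.ext hfst.symm hsnd ▸ hp'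

variable {L : Y → Y → Prop}

theorem mem_span_eigenvectors
    (hL : ∀ {K F K' F' : Y}, L K F → L K' F' → ⟪K, F'⟫_ℂ = ⟪F, K'⟫_ℂ) {s : Set ℝ}
    (hs : Submodule.span ℂ {F : Y | ∃ μ ∈ s, L (-(μ : ℂ) • F) F} = ⊤) {F K : Y} (h : L K F) :
    (F, K) ∈ Submodule.span ℂ {q : Y × Y | ∃ μ ∈ s, ∃ F, L (-(μ : ℂ) • F) F ∧
      q = (F, -(μ : ℂ) • F)} := by
  refine mem_span_of_symmetric (top_le_iff.1 (hs.ge.trans (Submodule.span_mono ?_))) ?_ ?_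
  · rintro F ⟨μ, hμ, hF⟩
    exact ⟨(F, -(μ : ℂ) • F), ⟨μ, hμ, F, hF, rfl⟩, rfl⟩
  · rintro _ ⟨μ, -, F, hF, rfl⟩ _ ⟨μ', -, F', hF', rfl⟩
    exact hL hF hF'
  · rintro _ ⟨μ', -, F', hF', rfl⟩
    exact hL h hF'

theorem eigenvalue_eq_or_inner_eq_zero
    (hL : ∀ {K F K' F' : Y}, L K F → L K' F' → ⟪K, F'⟫_ℂ = ⟪F, K'⟫_ℂ) {F F' : Y} {μ μ' : ℝ}
    (h : L (-(μ : ℂ) • F) F) (h' : L (-(μ' : ℂ) • F') F') : μ = μ' ∨ ⟪F, F'⟫_ℂ = 0 := by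
  have hinner := hL h h'
  rw [inner_smul_left, inner_smul_right, map_neg, Complex.conj_ofReal] at hinner
  have hmul : ((μ : ℂ) - μ') * ⟪F, F'⟫_ℂ = 0 := by linear_combination -hinner
  exact (mul_eq_zero.1 hmul).imp_left fun h0 => by exact_mod_cast sub_eq_zero.1 h0

end SymmetricRelation

section SeparatedOperator

variable {ι X X₁ X₂ Y : Type*} [NormedAddCommGroup X] [InnerProductSpace ℂ X]
  [NormedAddCommGroup X₁] [InnerProductSpace ℂ X₁] [NormedAddCommGroup X₂]
  [InnerProductSpace ℂ X₂] [NormedAddCommGroup Y] [InnerProductSpace ℂ Y]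

/-- The graph of the operator `p ⊗ 1 + w ⊗ (-a L - b)` obtained by separation of variables: `L K F`
stands for `K = L F`, and the operators of the first variable are given by the families `p` and `w`
of the images of the vectors `j s` spanning their domain. -/
noncomputable def separatedGraph (L : Y → Y → Prop) (j p w : ι → X) (a b : ℝ) :
    Submodule ℂ
      (UniformSpace.Completion (X ⊗[ℂ] Y) × UniformSpace.Completion (X ⊗[ℂ] Y)) :=
  Submodule.span ℂ {q | ∃ s F K, L K F ∧ q = (pureTensor (j s) F,
    pureTensor (p s) F + pureTensor (w s) (-((a : ℂ) • K) - (b : ℂ) • F))}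

/-- The eigenvectors of `-L`, paired with their eigenvalues `μ`, for which `a μ ≤ b`; as in
`separatedGraph`, `L K F` stands for `K = L F`. -/
abbrev NonposEigenpair (L : Y → Y → Prop) (a b : ℝ) :=
  {q : Y × ℝ // a * q.2 - b ≤ 0 ∧ L (-(q.2 : ℂ) • q.1) q.1}

variable {L : Y → Y → Prop} {a b : ℝ}

theorem separatedGraph_eq_span_range
    (hL : ∀ {K F K' F' : Y}, L K F → L K' F' → ⟪K, F'⟫_ℂ = ⟪F, K'⟫_ℂ)
    (hs : Submodule.span ℂ {F : Y | ∃ μ : ℝ, a * μ - b ≤ 0 ∧ L (-(μ : ℂ) • F) F} = ⊤)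
    (j p w : ι → X) :
    separatedGraph L j p w a b = Submodule.span ℂ (range fun i : ι × NonposEigenpair L a b =>
      (pureTensor (j i.1) i.2.1.1,
        pureTensor (p i.1 + ((a * i.2.1.2 - b : ℝ) : ℂ) • w i.1) i.2.1.1)) := by
  have heigen : ∀ s (F : Y) (μ : ℝ),
      pureTensor (p s) F + pureTensor (w s) (-((a : ℂ) • (-(μ : ℂ) • F)) - (b : ℂ) • F)
        = pureTensor (p s + ((a * μ - b : ℝ) : ℂ) • w s) F := fun s F μ => by
    have hF : -((a : ℂ) • (-(μ : ℂ) • F)) - (b : ℂ) • F = ((a * μ - b : ℝ) : ℂ) • F := by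
      push_cast
      module
    rw [hF, map_smul, map_add, map_smul, LinearMap.add_apply, LinearMap.smul_apply]
  refine le_antisymm (Submodule.span_le.2 ?_) (Submodule.span_le.2 ?_)
  · rintro _ ⟨s, F, K, hFK, rfl⟩
    let Φ : Y × Y →ₗ[ℂ] UniformSpace.Completion (X ⊗[ℂ] Y) × UniformSpace.Completion (X ⊗[ℂ] Y) :=
      (pureTensor (j s) ∘ₗ LinearMap.fst ℂ Y Y).prod (pureTensor (p s) ∘ₗ LinearMap.fst ℂ Y Y
        + pureTensor (w s) ∘ₗ (-((a : ℂ) • LinearMap.snd ℂ Y Y) - (b : ℂ) • LinearMap.fst ℂ Y Y))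
    change Φ (F, K) ∈ _
    refine Submodule.mem_comap.1 (Submodule.span_le.2 ?_
      (mem_span_eigenvectors hL (s := {μ | a * μ - b ≤ 0}) hs hFK))
    rintro _ ⟨μ, hμ, F, hF, rfl⟩
    exact Submodule.subset_span
      ⟨(s, ⟨(F, μ), hμ, hF⟩), Prod.ext rfl (heigen s F μ).symm⟩
  · rintro _ ⟨⟨s, ⟨F, μ⟩, hμ, hF⟩, rfl⟩
    exact Submodule.subset_span ⟨s, F, -(μ : ℂ) • F, hF, Prod.ext rfl (heigen s F μ).symm⟩

theorem isSelfAdjointInFriedrichsSense_separatedGraph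
    (hL : ∀ {K F K' F' : Y}, L K F → L K' F' → ⟪K, F'⟫_ℂ = ⟪F, K'⟫_ℂ)
    (hs : Submodule.span ℂ {F : Y | ∃ μ : ℝ, a * μ - b ≤ 0 ∧ L (-(μ : ℂ) • F) F} = ⊤)
    {c : ℝ} {j p w : ι → X} {d : ι → X₁} {e : ι → X₂} (hj : DenseRange j)
    (hp : ∀ s t, ⟪p s, j t⟫_ℂ = c * ⟪j s, j t⟫_ℂ - ⟪d s, d t⟫_ℂ)
    (hw : ∀ s t, ⟪w s, j t⟫_ℂ = ⟪e s, e t⟫_ℂ) :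
    IsSelfAdjointInFriedrichsSense (separatedGraph L j p w a b) := by
  rw [separatedGraph_eq_span_range hL hs]
  -- The form is `c` minus the squares of `d ⊗ F` and `√(b - a μ) (e ⊗ F)`.
  refine isSelfAdjointInFriedrichsSense_span (c := c) (d := fun i => WithLp.toLp 2
    (pureTensor (d i.1) i.2.1.1,
      (√(b - a * i.2.1.2) : ℂ) • pureTensor (e i.1) i.2.1.1)) ?_ ?_
  · rintro ⟨s, ⟨F, μ⟩, hμ, hF⟩ ⟨t, ⟨F', μ'⟩, hμ', hF'⟩
    simp only [WithLp.prod_inner_apply, inner_pureTensor, inner_smul_left, inner_smul_right,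
      inner_add_left, hp, hw, Complex.conj_ofReal]
    obtain rfl | h0 := eigenvalue_eq_or_inner_eq_zero hL hF hF'
    · have hsqrt : (√(b - a * μ) : ℂ) * √(b - a * μ) = ((b - a * μ : ℝ) : ℂ) := by
        exact_mod_cast Real.mul_self_sqrt (by linarith : 0 ≤ b - a * μ)
      push_cast at hsqrt ⊢
      linear_combination ⟪e s, e t⟫_ℂ * ⟪F, F'⟫_ℂ * hsqrt
    · simp [h0]
  · exact dense_of_pureTensor_mem hj hs fun s F ⟨μ, hμ, hF⟩ =>
      Submodule.subset_span ⟨(s, ⟨(F, μ), hμ, hF⟩), rfl⟩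

end SeparatedOperator

/-! ### The radial operators -/

section Radial

variable {I : Set ℝ}

theorem isLocallyFiniteMeasure_radialMeasure (I : Set ℝ) :
    IsLocallyFiniteMeasure (radialMeasure I 1) := by
  simp only [radialMeasure, Real.rpow_one]
  exact IsLocallyFiniteMeasure.withDensity_ofReal continuous_id

theorem ae_radialMeasure_of_forall_mem (hI : IsOpen I) {P : ℝ → Prop} (hP : ∀ r ∈ I, P r)
    (q : ℝ) : ∀ᵐ r ∂radialMeasure I q, P r := by
  refine (withDensity_absolutelyContinuous _ _).ae_le ?_
  filter_upwards [ae_restrict_mem hI.measurableSet] with r hr using hP r hr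

theorem inner_toLp_congr (hI : IsOpen I) {q : ℝ} {f g f' g' : ℝ → ℂ}
    (hf : MemLp f 2 (radialMeasure I q)) (hg : MemLp g 2 (radialMeasure I q))
    (hf' : MemLp f' 2 (radialMeasure I q)) (hg' : MemLp g' 2 (radialMeasure I q))
    (h : ∀ r ∈ I, ⟪f r, g r⟫_ℂ = ⟪f' r, g' r⟫_ℂ) :
    ⟪hf.toLp f, hg.toLp g⟫_ℂ = ⟪hf'.toLp f', hg'.toLp g'⟫_ℂ := by
  rw [L2.inner_def, L2.inner_def]
  refine integral_congr_ae ?_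
  filter_upwards [hf.coeFn_toLp, hg.coeFn_toLp, hf'.coeFn_toLp, hg'.coeFn_toLp,
    ae_radialMeasure_of_forall_mem hI h q] with r hfr hgr hfr' hgr' hr
  rw [hfr, hgr, hfr', hgr', hr]

theorem TestFn.eq_zero_of_notMem (u : TestFn I) {r : ℝ} (hr : r ∉ I ∩ Ioi 0) :
    (u : ℝ → ℂ) r = 0 :=
  image_eq_zero_of_notMem_tsupport fun h => hr (u.2.2.2 h)

theorem integral_radialMeasure_one {F : ℝ → ℂ} (hF : ∀ r, r ∉ I ∩ Ioi 0 → F r = 0) :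
    ∫ r, F r ∂radialMeasure I 1 = ∫ r : ℝ, (r : ℂ) * F r := by
  rw [radialMeasure, integral_withDensity_eq_integral_toReal_smul (by fun_prop) (by simp),
    ← setIntegral_eq_integral_of_forall_compl_eq_zero (f := fun r : ℝ => (r : ℂ) * F r) (s := I)
      fun r hr => by rw [hF r fun h => hr h.1, mul_zero]]
  refine integral_congr_ae (.of_forall fun r => ?_)
  dsimp only
  rcases lt_or_ge 0 r with hr | hr
  · rw [Real.rpow_one, ENNReal.toReal_ofReal hr.le, Complex.real_smul]
  · rw [hF r fun h => hr.not_gt h.2, smul_zero, mul_zero]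

theorem inner_toL2 (u v : TestFn I) :
    ⟪TestFn.toL2 I u, TestFn.toL2 I v⟫_ℂ
      = ∫ r : ℝ, (r : ℂ) * (starRingEnd ℂ ((u : ℝ → ℂ) r) * (v : ℝ → ℂ) r) := by
  rw [L2.inner_def, ← integral_radialMeasure_one (I := I)
    fun r hr => by rw [TestFn.eq_zero_of_notMem v hr, mul_zero]]
  refine integral_congr_ae ?_
  filter_upwards [(TestFn.memLp u).coeFn_toLp, (TestFn.memLp v).coeFn_toLp] with r hu hv
  change ⟪((TestFn.memLp u).toLp _) r, ((TestFn.memLp v).toLp _) r⟫_ℂ = _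
  rw [hu, hv, RCLike.inner_apply, mul_comm]

theorem integral_conj_deriv_mul (u v : TestFn I) :
    ∫ r, starRingEnd ℂ (deriv (u : ℝ → ℂ) r) * (v : ℝ → ℂ) r
      = -∫ r, starRingEnd ℂ ((u : ℝ → ℂ) r) * deriv (v : ℝ → ℂ) r := by
  have hint : ∀ f g : TestFn I,
      Integrable ((fun r => starRingEnd ℂ ((f : ℝ → ℂ) r)) * (g : ℝ → ℂ)) := fun f g =>
    ((Complex.continuous_conj.comp f.2.1.continuous).mul
      g.2.1.continuous).integrable_of_hasCompactSupport g.2.2.1.mul_left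
  have hparts := integral_mul_deriv_eq_deriv_mul_of_integrable
    (fun r _ => (TestFn.differentiable u r).hasDerivAt.star)
    (fun r _ => (TestFn.differentiable v r).hasDerivAt)
    (hint u (TestFn.derivMap I v)) (hint (TestFn.derivMap I u) v) (hint u v)
  exact (neg_eq_iff_eq_neg.2 hparts).symm

theorem inner_radialKinetic (u v : TestFn I) :
    ⟪TestFn.toL2 I (TestFn.radialKinetic I u), TestFn.toL2 I v⟫_ℂ
      = -⟪TestFn.toL2 I (TestFn.derivMap I u), TestFn.toL2 I (TestFn.derivMap I v)⟫_ℂ := by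
  set ru' := TestFn.rpowMul I 1 (TestFn.derivMap I u)
  calc ⟪TestFn.toL2 I (TestFn.radialKinetic I u), TestFn.toL2 I v⟫_ℂ
      = ∫ r, starRingEnd ℂ (deriv (ru' : ℝ → ℂ) r) * (v : ℝ → ℂ) r := by
        rw [inner_toL2]
        congr! 2 with r
        rcases lt_or_ge 0 r with hr | hr
        · change (r : ℂ) * (starRingEnd ℂ (((r ^ (-1 : ℝ) : ℝ) : ℂ) * deriv (ru' : ℝ → ℂ) r)
            * (v : ℝ → ℂ) r) = _
          rw [Real.rpow_neg_one, map_mul, Complex.conj_ofReal, Complex.ofReal_inv]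
          have hr' : (r : ℂ) ≠ 0 := Complex.ofReal_ne_zero.2 hr.ne'
          field_simp
        · rw [TestFn.eq_zero_of_notMem v fun h => hr.not_gt h.2, mul_zero, mul_zero, mul_zero]
    _ = -∫ r, starRingEnd ℂ ((ru' : ℝ → ℂ) r) * deriv (v : ℝ → ℂ) r :=
        integral_conj_deriv_mul ru' v
    _ = -⟪TestFn.toL2 I (TestFn.derivMap I u), TestFn.toL2 I (TestFn.derivMap I v)⟫_ℂ := by
        rw [inner_toL2]
        congr! 3 with r
        change starRingEnd ℂ (((r ^ (1 : ℝ) : ℝ) : ℂ) * deriv (u : ℝ → ℂ) r) * deriv (v : ℝ → ℂ) r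
          = (r : ℂ) * (starRingEnd ℂ (deriv (u : ℝ → ℂ) r) * deriv (v : ℝ → ℂ) r)
        rw [Real.rpow_one, map_mul, Complex.conj_ofReal, mul_assoc]

theorem inner_rpowMul_neg_two (hI : IsOpen I) (hpos : I ⊆ Ioi 0) (u v : TestFn I) :
    ⟪TestFn.toL2 I (TestFn.rpowMul I (-2) u), TestFn.toL2 I v⟫_ℂ
      = ⟪TestFn.toL2 I (TestFn.rpowMul I (-1) u), TestFn.toL2 I (TestFn.rpowMul I (-1) v)⟫_ℂ := by
  refine inner_toLp_congr hI (TestFn.memLp _) (TestFn.memLp _) (TestFn.memLp _)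
    (TestFn.memLp _) fun r hr => ?_
  change ⟪((r ^ (-2 : ℝ) : ℝ) : ℂ) * (u : ℝ → ℂ) r, (v : ℝ → ℂ) r⟫_ℂ
    = ⟪((r ^ (-1 : ℝ) : ℝ) : ℂ) * (u : ℝ → ℂ) r, ((r ^ (-1 : ℝ) : ℝ) : ℂ) * (v : ℝ → ℂ) r⟫_ℂ
  have hsq : r ^ (-2 : ℝ) = r ^ (-1 : ℝ) * r ^ (-1 : ℝ) := by
    rw [← Real.rpow_add (hpos hr)]; norm_num
  simp only [RCLike.inner_apply, map_mul, Complex.conj_ofReal, hsq, Complex.ofReal_mul]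
  ring

theorem denseRange_toL2 (hI : IsOpen I) (hpos : I ⊆ Ioi 0) : DenseRange (TestFn.toL2 I) := by
  have := isLocallyFiniteMeasure_radialMeasure I
  change Dense (LinearMap.range (TestFn.toL2 I) : Set (L2Radial I 1))
  rw [Submodule.dense_iff_topologicalClosure_eq_top,
    Submodule.topologicalClosure_eq_top_iff, Submodule.eq_bot_iff]
  intro w hw
  have hloc : LocallyIntegrableOn (w : ℝ → ℂ) I (radialMeasure I 1) :=
    ((Lp.memLp w).locallyIntegrable (by norm_num)).locallyIntegrableOn I
  have hw0 := hI.ae_eq_zero_of_integral_contDiff_smul_eq_zero hloc fun g hg hgc hgs => by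
    let u : TestFn I := ⟨fun r => (g r : ℂ), Complex.ofRealCLM.contDiff.comp hg,
      hgc.comp_left Complex.ofReal_zero,
      (tsupport_comp_subset Complex.ofReal_zero g).trans fun r hr => ⟨hgs hr, hpos (hgs hr)⟩⟩
    have hu : ⟪TestFn.toL2 I u, w⟫_ℂ = 0 := (Submodule.mem_orthogonal _ w).1 hw _ ⟨u, rfl⟩
    rw [← hu, L2.inner_def]
    refine integral_congr_ae ?_
    filter_upwards [(TestFn.memLp u).coeFn_toLp] with r hur
    change _ = ⟪((TestFn.memLp u).toLp _) r, _⟫_ℂ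
    rw [hur, RCLike.inner_apply, Complex.conj_ofReal, Complex.real_smul, mul_comm]
  refine Lp.eq_zero_iff_ae_eq_zero.2 ?_
  filter_upwards [hw0, ae_radialMeasure_of_forall_mem hI (fun _ hr => hr) 1] with r hr hrI
    using hr hrI

/-- The potential `A r² - B r^p` of the radial part of the Hamilton operator. -/
noncomputable def radialPotential (A B p r : ℝ) : ℝ := A * r ^ (2 : ℝ) - B * r ^ p

theorem continuous_radialPotential (A B : ℝ) {p : ℝ} (hp : 0 ≤ p) :
    Continuous (radialPotential A B p) :=
  (continuous_const.mul (Real.continuous_rpow_const zero_le_two)).sub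
    (continuous_const.mul (Real.continuous_rpow_const hp))

theorem bddAbove_radialPotential_image_of_bddAbove (A B : ℝ) {p : ℝ} (hp : 0 ≤ p)
    (hpos : I ⊆ Ioi 0) (hI : BddAbove I) : BddAbove (radialPotential A B p '' I) := by
  obtain ⟨b, hb⟩ := hI
  have hsub : I ⊆ Icc 0 b := fun r hr => ⟨(hpos hr).le, hb hr⟩
  exact (isCompact_Icc.bddAbove_image (continuous_radialPotential A B hp).continuousOn).mono
    (image_mono hsub)

theorem bddAbove_radialPotential_image_of_nonpos {A B : ℝ} (p : ℝ) (hA : A ≤ 0) (hB : 0 ≤ B)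
    (hpos : I ⊆ Ioi 0) : BddAbove (radialPotential A B p '' I) := by
  refine ⟨0, forall_mem_image.2 fun r hr => ?_⟩
  exact sub_nonpos.2 ((mul_nonpos_of_nonpos_of_nonneg hA (Real.rpow_nonneg (hpos hr).le 2)).trans
    (mul_nonneg hB (Real.rpow_nonneg (hpos hr).le p)))

theorem tendsto_radialPotential_atBot {A p : ℝ} (hA : A < 0) (B : ℝ) (hp : p < 2) :
    Tendsto (radialPotential A B p) atTop atBot := by
  have hdecay : Tendsto (fun r : ℝ => r ^ (p - 2)) atTop (𝓝 0) := by
    simpa only [neg_sub] using tendsto_rpow_neg_atTop (sub_pos.2 hp)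
  have hfactor : Tendsto (fun r : ℝ => A - B * r ^ (p - 2)) atTop (𝓝 A) := by
    simpa only [mul_zero, sub_zero] using tendsto_const_nhds.sub (hdecay.const_mul B)
  refine ((tendsto_rpow_atTop zero_lt_two).atTop_mul_neg hA hfactor).congr' ?_
  filter_upwards [eventually_gt_atTop 0] with r hr
  have hsplit : r ^ p = r ^ (2 : ℝ) * r ^ (p - 2) := by rw [← Real.rpow_add hr]; norm_num
  rw [radialPotential, hsplit]
  ring

theorem bddAbove_radialPotential_image_of_neg {A p : ℝ} (hA : A < 0) (B : ℝ) (hp : 0 ≤ p)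
    (hp2 : p < 2) (hpos : I ⊆ Ioi 0) : BddAbove (radialPotential A B p '' I) := by
  obtain ⟨R, hR⟩ := eventually_atTop.1
    ((tendsto_radialPotential_atBot hA B hp2).eventually_le_atBot 0)
  have hbdd := bddAbove_radialPotential_image_of_bddAbove A B hp Ioc_subset_Ioi_self
    (bddAbove_Ioc (b := 0) (a := R))
  refine (hbdd.union (bddAbove_Iic (a := 0))).mono (image_subset_iff.2 fun r hr => ?_)
  exact (le_total r R).imp (fun h => mem_image_of_mem _ ⟨hpos hr, h⟩) (hR r)

/-- The radial part `u ↦ r⁻¹ ∂_r (r ∂_r u) + (A r² - B r^p) u` of the Hamilton operator on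
`C_c^∞(I)`. -/
noncomputable def radialPart (I : Set ℝ) (A B p : ℝ) : TestFn I →ₗ[ℂ] TestFn I :=
  TestFn.radialKinetic I + ((A : ℂ) • TestFn.rpowMul I 2 - (B : ℂ) • TestFn.rpowMul I p)

theorem memLp_sqrt_mul {w : ℝ → ℝ} (hw : Continuous w) (u : TestFn I) :
    MemLp (fun r => (√(w r) : ℂ) * (u : ℝ → ℂ) r) 2 (radialMeasure I 1) := by
  have := isLocallyFiniteMeasure_radialMeasure I
  exact ((Complex.continuous_ofReal.comp hw.sqrt).mul
    u.2.1.continuous).memLp_of_hasCompactSupport u.2.2.1.mul_left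

theorem inner_sub_potential {A B c p : ℝ} (hI : IsOpen I)
    (hc : ∀ r ∈ I, radialPotential A B p r ≤ c)
    (hw : Continuous fun r => c - radialPotential A B p r) (u v : TestFn I) :
    ⟪(memLp_sqrt_mul hw u).toLp _, (memLp_sqrt_mul hw v).toLp _⟫_ℂ
      = (c : ℂ) * ⟪TestFn.toL2 I u, TestFn.toL2 I v⟫_ℂ
        - ⟪TestFn.toL2 I ((A : ℂ) • TestFn.rpowMul I 2 u - (B : ℂ) • TestFn.rpowMul I p u),
            TestFn.toL2 I v⟫_ℂ := by
  rw [← Complex.conj_ofReal c, ← inner_smul_left, ← map_smul, ← inner_sub_left, ← map_sub]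
  refine inner_toLp_congr hI _ _ (TestFn.memLp _) (TestFn.memLp _) fun r hr => ?_
  change _ = ⟪(c : ℂ) * (u : ℝ → ℂ) r - ((A : ℂ) * (((r ^ (2 : ℝ) : ℝ) : ℂ) * (u : ℝ → ℂ) r)
    - (B : ℂ) * (((r ^ p : ℝ) : ℂ) * (u : ℝ → ℂ) r)), (v : ℝ → ℂ) r⟫_ℂ
  have hsq : (√(c - radialPotential A B p r) : ℂ) * √(c - radialPotential A B p r)
      = (c : ℂ) - ((A : ℂ) * ((r ^ (2 : ℝ) : ℝ) : ℂ) - (B : ℂ) * ((r ^ p : ℝ) : ℂ)) := by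
    rw [← Complex.ofReal_mul, Real.mul_self_sqrt (sub_nonneg.2 (hc r hr)), radialPotential]
    push_cast
    rfl
  simp only [RCLike.inner_apply, map_mul, map_sub, Complex.conj_ofReal]
  linear_combination ((v : ℝ → ℂ) r * starRingEnd ℂ ((u : ℝ → ℂ) r)) * hsq

theorem exists_inner_radialPart_eq (hI : IsOpen I) {A B c p : ℝ} (hp : 0 ≤ p)
    (hc : ∀ r ∈ I, radialPotential A B p r ≤ c) :
    ∃ d : TestFn I → WithLp 2 (L2Radial I 1 × L2Radial I 1), ∀ u v : TestFn I,
      ⟪TestFn.toL2 I (radialPart I A B p u), TestFn.toL2 I v⟫_ℂ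
        = (c : ℂ) * ⟪TestFn.toL2 I u, TestFn.toL2 I v⟫_ℂ - ⟪d u, d v⟫_ℂ := by
  have hw : Continuous fun r => c - radialPotential A B p r :=
    continuous_const.sub (continuous_radialPotential A B hp)
  refine ⟨fun u => WithLp.toLp 2
    (TestFn.toL2 I (TestFn.derivMap I u), (memLp_sqrt_mul hw u).toLp _), fun u v => ?_⟩
  rw [WithLp.prod_inner_apply, inner_sub_potential hI hc hw, radialPart, LinearMap.add_apply,
    map_add, inner_add_left, inner_radialKinetic]
  simp only [LinearMap.sub_apply, LinearMap.smul_apply]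
  ring

end Radial

/-! ### The metric in charts -/

section Chart

variable {m : ℕ} {S : Type*} [TopologicalSpace S] [ChartedSpace (EuclideanSpace ℝ (Fin m)) S]

/-- The coordinate change from the chart around `x` to the chart around `y`. -/
noncomputable def chartChange (x y : S) :
    PartialEquiv (EuclideanSpace ℝ (Fin m)) (EuclideanSpace ℝ (Fin m)) :=
  (extChartAt (𝓡 m) x).symm ≫ extChartAt (𝓡 m) y

/-- The Jacobian matrix of the coordinate change. -/
noncomputable def chartJacobian (x y : S) (z : EuclideanSpace ℝ (Fin m)) :
    Matrix (Fin m) (Fin m) ℝ :=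
  LinearMap.toMatrix (EuclideanSpace.basisFun (Fin m) ℝ).toBasis
    (EuclideanSpace.basisFun (Fin m) ℝ).toBasis (fderiv ℝ (chartChange (m := m) x y) z).toLinearMap

theorem det_chartJacobian (x y : S) (z : EuclideanSpace ℝ (Fin m)) :
    (chartJacobian (m := m) x y z).det = (fderiv ℝ (chartChange (m := m) x y) z).det :=
  LinearMap.det_toMatrix _ _

theorem chartJacobian_apply (x y : S) (z : EuclideanSpace ℝ (Fin m)) (C A : Fin m) :
    chartJacobian x y z C A
      = fderiv ℝ (chartChange (m := m) x y) z (EuclideanSpace.single A (1 : ℝ)) C := by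
  simp [chartJacobian, LinearMap.toMatrix_apply]

theorem symm_chartChange {x y : S} {z : EuclideanSpace ℝ (Fin m)}
    (hz : z ∈ (chartChange (m := m) x y).source) :
    (extChartAt (𝓡 m) y).symm (chartChange x y z) = (extChartAt (𝓡 m) x).symm z :=
  (extChartAt (𝓡 m) y).left_inv hz.2

theorem isOpen_chartChange_source (x y : S) : IsOpen (chartChange (m := m) x y).source :=
  (continuousOn_extChartAt_symm x).isOpen_inter_preimage (isOpen_extChartAt_target x)
    (isOpen_extChartAt_source y)

theorem symm_chart_eventuallyEq {x y : S} {z : EuclideanSpace ℝ (Fin m)}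
    (hz : z ∈ (chartChange (m := m) x y).source) :
    (extChartAt (𝓡 m) x).symm =ᶠ[𝓝 z] (extChartAt (𝓡 m) y).symm ∘ chartChange x y := by
  filter_upwards [(isOpen_chartChange_source x y).mem_nhds hz] with w hw
    using (symm_chartChange hw).symm

variable [IsManifold (𝓡 m) ∞ S]

theorem mdifferentiableAt_symm_chart {x : S} {z : EuclideanSpace ℝ (Fin m)}
    (hz : z ∈ (extChartAt (𝓡 m) x).target) :
    MDifferentiableAt (𝓡 m) (𝓡 m) (extChartAt (𝓡 m) x).symm z :=
  ((contMDiffOn_extChartAt_symm (n := ∞) x).contMDiffAt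
    ((isOpen_extChartAt_target x).mem_nhds hz)).mdifferentiableAt (by simp)

theorem contDiffOn_chartChange (x y : S) :
    ContDiffOn ℝ ∞ (chartChange (m := m) x y) (chartChange (m := m) x y).source :=
  contDiffOn_ext_coord_change y x

theorem differentiableAt_chartChange {x y : S} {z : EuclideanSpace ℝ (Fin m)}
    (hz : z ∈ (chartChange (m := m) x y).source) :
    DifferentiableAt ℝ (chartChange (m := m) x y) z :=
  ((contDiffOn_chartChange x y).contDiffAt
    ((isOpen_chartChange_source x y).mem_nhds hz)).differentiableAt (by simp)

/-- The derivative at `z` of the inverse of the chart around `x`, with the tangent space of `S`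
identified with the model space. -/
noncomputable def symmChartDeriv (x : S) (z : EuclideanSpace ℝ (Fin m)) :
    EuclideanSpace ℝ (Fin m) →L[ℝ] EuclideanSpace ℝ (Fin m) :=
  mfderiv (𝓡 m) (𝓡 m) (extChartAt (𝓡 m) x).symm z

theorem injective_symmChartDeriv {x : S} {z : EuclideanSpace ℝ (Fin m)}
    (hz : z ∈ (extChartAt (𝓡 m) x).target) : Function.Injective (symmChartDeriv x z) := by
  have hinv := isInvertible_mfderivWithin_extChartAt_symm (I := 𝓡 m) hz
  rw [ModelWithCorners.range_eq_univ, mfderivWithin_univ] at hinv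
  exact hinv.injective

theorem symmChartDeriv_eq_comp {x y : S} {z : EuclideanSpace ℝ (Fin m)}
    (hz : z ∈ (chartChange (m := m) x y).source) :
    symmChartDeriv x z
      = (symmChartDeriv y (chartChange x y z)).comp (fderiv ℝ (chartChange (m := m) x y) z) := by
  have hchain := mfderiv_comp z
    (mdifferentiableAt_symm_chart ((chartChange (m := m) x y).map_source hz).1)
    (mdifferentiableAt_iff_differentiableAt.2 (differentiableAt_chartChange hz))
  rw [mfderiv_eq_fderiv] at hchain
  exact (symm_chart_eventuallyEq hz).mfderiv_eq.trans hchain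

/-- The metric as a bilinear form in the coordinates of the chart around `x`. -/
noncomputable def chartMetric (G : Metric m S) (x : S) (z : EuclideanSpace ℝ (Fin m)) :
    LinearMap.BilinForm ℝ (EuclideanSpace ℝ (Fin m)) :=
  LinearMap.compl₁₂ (ContinuousLinearMap.toLinearMap₁₂ (G.inner ((extChartAt (𝓡 m) x).symm z)))
    (symmChartDeriv x z).toLinearMap (symmChartDeriv x z).toLinearMap

theorem toMatrix_chartMetric (G : Metric m S) (x : S) (z : EuclideanSpace ℝ (Fin m)) :
    LinearMap.toMatrix₂ (EuclideanSpace.basisFun (Fin m) ℝ).toBasis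
      (EuclideanSpace.basisFun (Fin m) ℝ).toBasis (chartMetric G x z) = metricMatrix G x z := by
  ext A B
  rw [LinearMap.toMatrix₂_apply, OrthonormalBasis.coe_toBasis, EuclideanSpace.basisFun_apply,
    EuclideanSpace.basisFun_apply]
  rfl

theorem chartMetric_eq_compl₁₂ (G : Metric m S) {x y : S} {z : EuclideanSpace ℝ (Fin m)}
    (hz : z ∈ (chartChange (m := m) x y).source) :
    chartMetric G x z = (chartMetric G y (chartChange x y z)).compl₁₂
      (fderiv ℝ (chartChange (m := m) x y) z).toLinearMap
      (fderiv ℝ (chartChange (m := m) x y) z).toLinearMap := by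
  rw [chartMetric, chartMetric, symmChartDeriv_eq_comp hz, symm_chartChange hz]
  rfl

theorem metricMatrix_eq (G : Metric m S) {x y : S} {z : EuclideanSpace ℝ (Fin m)}
    (hz : z ∈ (chartChange (m := m) x y).source) :
    metricMatrix G x z = (chartJacobian x y z).transpose
      * metricMatrix G y (chartChange x y z) * chartJacobian x y z := by
  rw [← toMatrix_chartMetric, ← toMatrix_chartMetric, chartMetric_eq_compl₁₂ G hz]
  exact LinearMap.toMatrix₂_compl₁₂ _ _ _ _ _ _ _

theorem posDef_metricMatrix (G : Metric m S) (x : S) {z : EuclideanSpace ℝ (Fin m)}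
    (hz : z ∈ (extChartAt (𝓡 m) x).target) : (metricMatrix G x z).PosDef := by
  refine Matrix.PosDef.of_dotProduct_mulVec_pos ?_ fun v hv => ?_
  · ext A B
    simp only [Matrix.conjTranspose_apply, metricMatrix, Matrix.of_apply, star_trivial]
    exact G.symm _ _ _
  · have hquad : v ⬝ᵥ (metricMatrix G x z).mulVec v
        = chartMetric G x z (WithLp.toLp 2 v) (WithLp.toLp 2 v) := by
      rw [← toMatrix_chartMetric]
      exact (apply_eq_dotProduct_toMatrix₂_mulVec (EuclideanSpace.basisFun (Fin m) ℝ).toBasis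
        (EuclideanSpace.basisFun (Fin m) ℝ).toBasis (chartMetric G x z) (WithLp.toLp 2 v)
        (WithLp.toLp 2 v)).symm
    rw [star_trivial, hquad]
    refine G.pos _ _ fun h => hv ?_
    exact (WithLp.toLp_eq_zero 2).1
      (injective_symmChartDeriv hz (h.trans (map_zero (symmChartDeriv x z)).symm))

theorem det_metricMatrix_pos (G : Metric m S) (x : S) {z : EuclideanSpace ℝ (Fin m)}
    (hz : z ∈ (extChartAt (𝓡 m) x).target) : 0 < (metricMatrix G x z).det :=
  (posDef_metricMatrix G x hz).det_pos

theorem volDensity_pos (G : Metric m S) (x : S) {z : EuclideanSpace ℝ (Fin m)}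
    (hz : z ∈ (extChartAt (𝓡 m) x).target) : 0 < volDensity G x z :=
  Real.sqrt_pos.2 (det_metricMatrix_pos G x hz)

theorem volDensity_eq (G : Metric m S) {x y : S} {z : EuclideanSpace ℝ (Fin m)}
    (hz : z ∈ (chartChange (m := m) x y).source) :
    volDensity G x z = |(fderiv ℝ (chartChange (m := m) x y) z).det|
      * volDensity G y (chartChange x y z) := by
  rw [volDensity, volDensity, metricMatrix_eq G hz, Matrix.det_mul, Matrix.det_mul,
    Matrix.det_transpose, ← det_chartJacobian, mul_right_comm, Real.sqrt_mul (mul_self_nonneg _),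
    Real.sqrt_mul_self_eq_abs]

theorem metricMatrix_inv_eq (G : Metric m S) {x y : S} {z : EuclideanSpace ℝ (Fin m)}
    (hz : z ∈ (chartChange (m := m) x y).source) :
    (metricMatrix G y (chartChange x y z))⁻¹ = chartJacobian x y z * (metricMatrix G x z)⁻¹
      * (chartJacobian x y z).transpose := by
  have hM := metricMatrix_eq G hz
  have hJ : IsUnit (chartJacobian x y z).det := by
    refine isUnit_iff_ne_zero.2 fun h => (det_metricMatrix_pos G x hz.1).ne' ?_
    rw [hM, Matrix.det_mul, h, mul_zero]
  have hJt : IsUnit (chartJacobian x y z).transpose.det := by rwa [Matrix.det_transpose]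
  rw [hM, Matrix.mul_inv_rev, Matrix.mul_inv_rev, ← mul_assoc, Matrix.mul_nonsing_inv _ hJ,
    one_mul, mul_assoc, Matrix.nonsing_inv_mul _ hJt, mul_one]

theorem contMDiffOn_coordVec (x : S) (A : Fin m) :
    ContMDiffOn (𝓡 m) (𝓡 m).tangent ∞
      (fun z => (⟨(extChartAt (𝓡 m) x).symm z, coordVec x z A⟩ : TangentBundle (𝓡 m) S))
      (extChartAt (𝓡 m) x).target := by
  have hopen := isOpen_extChartAt_target (I := 𝓡 m) x
  have htangent := (contMDiffOn_extChartAt_symm (n := ∞) x).contMDiffOn_tangentMapWithin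
    (m := ∞) (by simp) hopen.uniqueMDiffOn
  have hconst : ContMDiff (𝓡 m) (𝓡 m).tangent ∞ (fun z : EuclideanSpace ℝ (Fin m) =>
      (⟨z, EuclideanSpace.single A (1 : ℝ)⟩ :
        TangentBundle (𝓡 m) (EuclideanSpace ℝ (Fin m)))) :=
    (contMDiff_vectorSpace_iff_contDiff (𝕜 := ℝ) (n := ∞)
      (V := fun z : EuclideanSpace ℝ (Fin m) => (EuclideanSpace.single A (1 : ℝ) :
        TangentSpace 𝓘(ℝ, EuclideanSpace ℝ (Fin m)) z))).2 contDiff_const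
  refine (htangent.comp hconst.contMDiffOn (s := (extChartAt (𝓡 m) x).target)
    fun z hz => hz).congr fun z hz => ?_
  simp only [Function.comp_apply, tangentMapWithin, coordVec]
  rw [mfderivWithin_of_isOpen hopen hz]

theorem contDiffOn_metricMatrix (G : Metric m S) (x : S) (A B : Fin m) :
    ContDiffOn ℝ ∞ (fun z => metricMatrix G x z A B) (extChartAt (𝓡 m) x).target := by
  rw [← contMDiffOn_iff_contDiffOn]
  intro z hz
  have hsection : ContMDiffWithinAt (𝓡 m) ((𝓡 m).prod 𝓘(ℝ)) ∞
      (fun z => Bundle.TotalSpace.mk' ℝ (E := Bundle.Trivial S ℝ) ((extChartAt (𝓡 m) x).symm z)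
        (G.inner ((extChartAt (𝓡 m) x).symm z) (coordVec x z A) (coordVec x z B)))
      (extChartAt (𝓡 m) x).target z := by
    apply ContMDiffWithinAt.clm_bundle_apply₂ (F₁ := EuclideanSpace ℝ (Fin m))
      (F₂ := EuclideanSpace ℝ (Fin m))
    · exact G.contMDiff.contMDiffAt.comp_contMDiffWithinAt z (contMDiffOn_extChartAt_symm x z hz)
    · exact contMDiffOn_coordVec x A z hz
    · exact contMDiffOn_coordVec x B z hz
  exact (Bundle.contMDiffWithinAt_totalSpace.1 hsection).2

theorem contDiffOn_det {n : ℕ∞ω} {𝕜 X ι : Type*} [NontriviallyNormedField 𝕜] [Fintype ι]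
    [DecidableEq ι] [NormedAddCommGroup X] [NormedSpace 𝕜 X] {M : X → Matrix ι ι 𝕜} {s : Set X}
    (hM : ∀ A B, ContDiffOn 𝕜 n (fun z => M z A B) s) :
    ContDiffOn 𝕜 n (fun z => (M z).det) s := by
  simp only [Matrix.det_apply']
  exact ContDiffOn.sum fun σ _ => contDiffOn_const.mul (contDiffOn_prod fun i _ => hM _ _)

theorem contDiffOn_matrix_inv_apply {n : ℕ∞ω} {𝕜 X ι : Type*} [NontriviallyNormedField 𝕜]
    [Fintype ι] [DecidableEq ι] [NormedAddCommGroup X] [NormedSpace 𝕜 X] {M : X → Matrix ι ι 𝕜}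
    {s : Set X} (hM : ∀ A B, ContDiffOn 𝕜 n (fun z => M z A B) s)
    (hdet : ∀ z ∈ s, (M z).det ≠ 0) (A B : ι) : ContDiffOn 𝕜 n (fun z => (M z)⁻¹ A B) s := by
  simp only [Matrix.inv_def, Matrix.smul_apply, Ring.inverse_eq_inv', smul_eq_mul,
    Matrix.adjugate_apply]
  refine ((contDiffOn_det hM).inv hdet).mul (contDiffOn_det fun C D => ?_)
  rcases eq_or_ne C B with rfl | hCB
  · simpa only [Matrix.updateRow_self] using contDiffOn_const
  · simpa only [Matrix.updateRow_ne hCB] using hM C D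

theorem contDiffOn_volDensity (G : Metric m S) (x : S) :
    ContDiffOn ℝ ∞ (volDensity G x) (extChartAt (𝓡 m) x).target :=
  (contDiffOn_det (contDiffOn_metricMatrix G x)).sqrt fun _ hz => (det_metricMatrix_pos G x hz).ne'

theorem contDiffOn_metricMatrix_inv (G : Metric m S) (x : S) (A B : Fin m) :
    ContDiffOn ℝ ∞ (fun z => (metricMatrix G x z)⁻¹ A B) (extChartAt (𝓡 m) x).target :=
  contDiffOn_matrix_inv_apply (contDiffOn_metricMatrix G x)
    (fun _ hz => (det_metricMatrix_pos G x hz).ne') A B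

theorem contDiffOn_comp_symm_chart {f : S → ℂ} (hf : ContMDiff (𝓡 m) 𝓘(ℝ, ℂ) ∞ f) (x : S) :
    ContDiffOn ℝ ∞ (f ∘ (extChartAt (𝓡 m) x).symm) (extChartAt (𝓡 m) x).target :=
  contMDiffOn_iff_contDiffOn.1 (hf.comp_contMDiffOn (contMDiffOn_extChartAt_symm x))

theorem differentiableAt_comp_symm_chart {f : S → ℂ} (hf : ContMDiff (𝓡 m) 𝓘(ℝ, ℂ) ∞ f) {x : S}
    {z : EuclideanSpace ℝ (Fin m)} (hz : z ∈ (extChartAt (𝓡 m) x).target) :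
    DifferentiableAt ℝ (f ∘ (extChartAt (𝓡 m) x).symm) z :=
  ((contDiffOn_comp_symm_chart hf x).contDiffAt
    ((isOpen_extChartAt_target x).mem_nhds hz)).differentiableAt (by simp)

/-- The vector `(∂_A F)` of the partial derivatives of a function of the coordinates. -/
noncomputable def partials (F : EuclideanSpace ℝ (Fin m) → ℂ) (z : EuclideanSpace ℝ (Fin m)) :
    Fin m → ℂ :=
  fun A => fderiv ℝ F z (EuclideanSpace.single A (1 : ℝ))

theorem partials_comp_symm_chart {f : S → ℂ} (hf : ContMDiff (𝓡 m) 𝓘(ℝ, ℂ) ∞ f) {x y : S}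
    {z : EuclideanSpace ℝ (Fin m)} (hz : z ∈ (chartChange (m := m) x y).source) :
    partials (f ∘ (extChartAt (𝓡 m) x).symm) z
      = Matrix.vecMul (partials (f ∘ (extChartAt (𝓡 m) y).symm) (chartChange x y z))
        ((chartJacobian x y z).map Complex.ofRealHom) := by
  have hchain : fderiv ℝ (f ∘ (extChartAt (𝓡 m) x).symm) z
      = (fderiv ℝ (f ∘ (extChartAt (𝓡 m) y).symm) (chartChange x y z)).comp
        (fderiv ℝ (chartChange (m := m) x y) z) :=
    ((symm_chart_eventuallyEq hz).fun_comp f).fderiv_eq.trans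
      (fderiv_comp z
        (differentiableAt_comp_symm_chart hf ((chartChange (m := m) x y).map_source hz).1)
        (differentiableAt_chartChange hz))
  ext A
  have hcol : fderiv ℝ (chartChange (m := m) x y) z (EuclideanSpace.single A (1 : ℝ))
      = ∑ C, chartJacobian x y z C A • EuclideanSpace.single C (1 : ℝ) := by
    ext B
    simp [Finset.sum_apply, Pi.single_apply, chartJacobian_apply]
  rw [partials, hchain, ContinuousLinearMap.comp_apply, hcol, map_sum]
  simp only [map_smul, Matrix.vecMul, dotProduct, Matrix.map_apply, partials, Complex.real_smul]
  exact Finset.sum_congr rfl fun C _ => mul_comm _ _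

/-- The expression `G^{AB} ∂_A F ∂_B H` in the chart around `x`. -/
noncomputable def chartPairing (G : Metric m S) (x : S) (F H : EuclideanSpace ℝ (Fin m) → ℂ)
    (z : EuclideanSpace ℝ (Fin m)) : ℂ :=
  partials F z ⬝ᵥ ((metricMatrix G x z)⁻¹.map Complex.ofRealHom).mulVec (partials H z)

theorem chartPairing_eq (G : Metric m S) {f h : S → ℂ} (hf : ContMDiff (𝓡 m) 𝓘(ℝ, ℂ) ∞ f)
    (hh : ContMDiff (𝓡 m) 𝓘(ℝ, ℂ) ∞ h) {x y : S} {z : EuclideanSpace ℝ (Fin m)}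
    (hz : z ∈ (chartChange (m := m) x y).source) :
    chartPairing G x (f ∘ (extChartAt (𝓡 m) x).symm) (h ∘ (extChartAt (𝓡 m) x).symm) z
      = chartPairing G y (f ∘ (extChartAt (𝓡 m) y).symm) (h ∘ (extChartAt (𝓡 m) y).symm)
        (chartChange x y z) := by
  rw [chartPairing, chartPairing, partials_comp_symm_chart hf hz, partials_comp_symm_chart hh hz,
    metricMatrix_inv_eq G hz, Matrix.map_mul, Matrix.map_mul, ← Matrix.dotProduct_mulVec,
    ← Matrix.mulVec_transpose, Matrix.mulVec_mulVec, Matrix.mulVec_mulVec, Matrix.transpose_map]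

/-- The expression `G^{AB} ∂_A f ∂_B h` as a function on `S`, computed at each point in the
preferred chart around that point. -/
noncomputable def gradPairing (G : Metric m S) (f h : S → ℂ) (p : S) : ℂ :=
  chartPairing G p (f ∘ (extChartAt (𝓡 m) p).symm) (h ∘ (extChartAt (𝓡 m) p).symm)
    (extChartAt (𝓡 m) p p)

theorem gradPairing_symm_chart (G : Metric m S) {f h : S → ℂ} (hf : ContMDiff (𝓡 m) 𝓘(ℝ, ℂ) ∞ f)
    (hh : ContMDiff (𝓡 m) 𝓘(ℝ, ℂ) ∞ h) {x : S} {z : EuclideanSpace ℝ (Fin m)}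
    (hz : z ∈ (extChartAt (𝓡 m) x).target) :
    gradPairing G f h ((extChartAt (𝓡 m) x).symm z)
      = chartPairing G x (f ∘ (extChartAt (𝓡 m) x).symm) (h ∘ (extChartAt (𝓡 m) x).symm) z :=
  (chartPairing_eq G hf hh ⟨hz, mem_extChartAt_source _⟩).symm

end Chart

/-! ### Integration in charts -/

section Volume

variable {m : ℕ} {S : Type*} [TopologicalSpace S] [ChartedSpace (EuclideanSpace ℝ (Fin m)) S]
  {F : Type*} [NormedAddCommGroup F]

theorem isCompact_image_chart [CompactSpace S] {x : S} {K : Set S} (hK : IsClosed K)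
    (hKx : K ⊆ (extChartAt (𝓡 m) x).source) : IsCompact (extChartAt (𝓡 m) x '' K) :=
  hK.isCompact.image_of_continuousOn ((continuousOn_extChartAt x).mono hKx)

theorem image_chart_subset_target {x : S} {K : Set S}
    (hKx : K ⊆ (extChartAt (𝓡 m) x).source) :
    extChartAt (𝓡 m) x '' K ⊆ (extChartAt (𝓡 m) x).target :=
  ((extChartAt (𝓡 m) x).mapsTo.mono_left hKx).image_subset

theorem symm_chart_notMem {x : S} {K : Set S} {z : EuclideanSpace ℝ (Fin m)}
    (hz : z ∈ (extChartAt (𝓡 m) x).target) (hzK : z ∉ extChartAt (𝓡 m) x '' K) :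
    (extChartAt (𝓡 m) x).symm z ∉ K :=
  fun h => hzK ⟨_, h, (extChartAt (𝓡 m) x).right_inv hz⟩

theorem integrableOn_chart [CompactSpace S] {x : S} {K : Set S} (hK : IsClosed K)
    (hKx : K ⊆ (extChartAt (𝓡 m) x).source) {h : EuclideanSpace ℝ (Fin m) → F}
    (hc : ContinuousOn h (extChartAt (𝓡 m) x).target)
    (h0 : ∀ z ∈ (extChartAt (𝓡 m) x).target, (extChartAt (𝓡 m) x).symm z ∉ K → h z = 0) :
    IntegrableOn h (extChartAt (𝓡 m) x).target :=
  ((hc.mono (image_chart_subset_target hKx)).integrableOn_compact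
    (isCompact_image_chart hK hKx)).of_forall_sdiff_eq_zero
      (isOpen_extChartAt_target x).measurableSet fun z hz => h0 z hz.1 (symm_chart_notMem hz.1 hz.2)

theorem continuousOn_comp_symm_chart {Y : Type*} [TopologicalSpace Y] {k : S → Y}
    (hk : Continuous k) (x : S) :
    ContinuousOn (fun z => k ((extChartAt (𝓡 m) x).symm z)) (extChartAt (𝓡 m) x).target :=
  hk.comp_continuousOn (continuousOn_extChartAt_symm x)

variable [IsManifold (𝓡 m) ∞ S] [NormedSpace ℝ F]

theorem setIntegral_volDensity_smul_eq (G : Metric m S) (x y : S) {k : S → F}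
    (hx : ∀ p ∉ (extChartAt (𝓡 m) x).source, k p = 0)
    (hy : ∀ p ∉ (extChartAt (𝓡 m) y).source, k p = 0) :
    ∫ z in (extChartAt (𝓡 m) y).target, volDensity G y z • k ((extChartAt (𝓡 m) y).symm z)
      = ∫ z in (extChartAt (𝓡 m) x).target,
        volDensity G x z • k ((extChartAt (𝓡 m) x).symm z) := by
  have hmeas := (isOpen_chartChange_source (m := m) x y).measurableSet
  calc ∫ z in (extChartAt (𝓡 m) y).target, volDensity G y z • k ((extChartAt (𝓡 m) y).symm z)
    _ = ∫ z in chartChange x y '' (chartChange (m := m) x y).source,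
        volDensity G y z • k ((extChartAt (𝓡 m) y).symm z) := by
      rw [(chartChange x y).image_source_eq_target]
      refine setIntegral_eq_of_subset_of_forall_sdiff_eq_zero
        (isOpen_extChartAt_target y).measurableSet inter_subset_left fun z hz => ?_
      exact smul_eq_zero_of_right _ (hx _ fun h => hz.2 ⟨hz.1, h⟩)
    _ = ∫ z in (chartChange (m := m) x y).source, |(fderiv ℝ (chartChange (m := m) x y) z).det| •
        volDensity G y (chartChange x y z) •
          k ((extChartAt (𝓡 m) y).symm (chartChange x y z)) :=
      integral_image_eq_integral_abs_det_fderiv_smul volume hmeas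
        (fun z hz => (differentiableAt_chartChange hz).hasFDerivAt.hasFDerivWithinAt)
        (chartChange x y).injOn _
    _ = ∫ z in (chartChange (m := m) x y).source,
        volDensity G x z • k ((extChartAt (𝓡 m) x).symm z) :=
      setIntegral_congr_fun hmeas fun z hz => by
        simp only [symm_chartChange hz, volDensity_eq G hz, mul_smul]
    _ = ∫ z in (extChartAt (𝓡 m) x).target,
        volDensity G x z • k ((extChartAt (𝓡 m) x).symm z) := by
      refine (setIntegral_eq_of_subset_of_forall_sdiff_eq_zero
        (isOpen_extChartAt_target x).measurableSet inter_subset_left fun z hz => ?_).symm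
      exact smul_eq_zero_of_right _ (hy _ fun h => hz.2 ⟨hz.1, h⟩)

variable [T2Space S] [CompactSpace S]

theorem tsupport_partitionOfUnity_subset (x : S) :
    tsupport (partitionOfUnity m S x) ⊆ (extChartAt (𝓡 m) x).source := by
  rw [extChartAt_source]
  exact (SmoothPartitionOfUnity.exists_isSubordinate_chartAt_source (𝓡 m) S).choose_spec x

theorem exists_finset_partitionOfUnity (m : ℕ) (S : Type*) [TopologicalSpace S]
    [ChartedSpace (EuclideanSpace ℝ (Fin m)) S] [IsManifold (𝓡 m) ∞ S] [T2Space S]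
    [CompactSpace S] : ∃ s : Finset S, (∀ x ∉ s, ∀ p, partitionOfUnity m S x p = 0) ∧
      ∀ p, ∑ x ∈ s, partitionOfUnity m S x p = 1 := by
  have hfin := (partitionOfUnity m S).locallyFinite.finite_nonempty_of_compact
  have h0 : ∀ x ∉ hfin.toFinset, ∀ p, partitionOfUnity m S x p = 0 := fun x hx p => by
    by_contra h
    exact hx (hfin.mem_toFinset.2 ⟨p, h⟩)
  refine ⟨hfin.toFinset, h0, fun p =>
    (partitionOfUnity m S).sum_finsupport' p (mem_univ p) fun x hx => ?_⟩
  by_contra h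
  exact ((partitionOfUnity m S).mem_finsupport p).1 hx (h0 x h p)

/-- The density of the contribution of the chart around `x` to the volume measure. -/
noncomputable def chartWeight (G : Metric m S) (x : S) (z : EuclideanSpace ℝ (Fin m)) : ℝ :=
  partitionOfUnity m S x ((extChartAt (𝓡 m) x).symm z) * volDensity G x z

theorem chartWeight_nonneg (G : Metric m S) (x : S) (z : EuclideanSpace ℝ (Fin m)) :
    0 ≤ chartWeight G x z :=
  mul_nonneg ((partitionOfUnity m S).nonneg x _) (Real.sqrt_nonneg _)

theorem continuousOn_chartWeight (G : Metric m S) (x : S) :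
    ContinuousOn (chartWeight G x) (extChartAt (𝓡 m) x).target :=
  (continuousOn_comp_symm_chart (partitionOfUnity m S x).contMDiff.continuous x).mul
    (contDiffOn_volDensity G x).continuousOn

theorem integrableOn_chartWeight (G : Metric m S) (x : S) :
    IntegrableOn (chartWeight G x) (extChartAt (𝓡 m) x).target :=
  integrableOn_chart (isClosed_tsupport _) (tsupport_partitionOfUnity_subset x)
    (continuousOn_chartWeight G x) fun z _ h => by
      rw [chartWeight, image_eq_zero_of_notMem_tsupport h, zero_mul]

theorem setIntegral_chartWeight_smul (G : Metric m S) (x y : S) {k : S → F}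
    (hx : ∀ p ∉ (extChartAt (𝓡 m) x).source, k p = 0) :
    ∫ z in (extChartAt (𝓡 m) y).target, chartWeight G y z • k ((extChartAt (𝓡 m) y).symm z)
      = ∫ z in (extChartAt (𝓡 m) x).target, volDensity G x z •
        partitionOfUnity m S y ((extChartAt (𝓡 m) x).symm z) •
          k ((extChartAt (𝓡 m) x).symm z) := by
  rw [← setIntegral_volDensity_smul_eq G x y (k := fun p => partitionOfUnity m S y p • k p)
    (fun p hp => by rw [hx p hp, smul_zero]) fun p hp => by
      rw [image_eq_zero_of_notMem_tsupport fun h => hp (tsupport_partitionOfUnity_subset y h),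
        zero_smul]]
  simp only [chartWeight, smul_smul, mul_comm]

variable [MeasurableSpace S]

/-- The contribution of the chart around `x` to the volume measure. -/
noncomputable def chartVolume (G : Metric m S) (x : S) : Measure S :=
  ((volume.restrict (extChartAt (𝓡 m) x).target).withDensity fun z =>
    ENNReal.ofReal (chartWeight G x z)).map (extChartAt (𝓡 m) x).symm

theorem riemannianVolume_eq_sum (G : Metric m S) {s : Finset S}
    (hs : ∀ x ∉ s, ∀ p, partitionOfUnity m S x p = 0) :
    riemannianVolume G = ∑ x ∈ s, chartVolume G x := by
  ext t ht
  rw [riemannianVolume, Measure.sum_apply _ ht, tsum_eq_sum (s := s), Measure.finsetSum_apply]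
  · rfl
  · intro x hx
    simp [hs x hx]

theorem isFiniteMeasure_chartVolume (G : Metric m S) (x : S) :
    IsFiniteMeasure (chartVolume G x) := by
  have : IsFiniteMeasure ((volume.restrict (extChartAt (𝓡 m) x).target).withDensity fun z =>
      ENNReal.ofReal (chartWeight G x z)) :=
    isFiniteMeasure_withDensity_ofReal (integrableOn_chartWeight G x).2
  exact Measure.isFiniteMeasure_map _ _

theorem isFiniteMeasure_riemannianVolume (G : Metric m S) :
    IsFiniteMeasure (riemannianVolume G) := by
  obtain ⟨s, hs, -⟩ := exists_finset_partitionOfUnity m S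
  have := isFiniteMeasure_chartVolume G
  rw [riemannianVolume_eq_sum G hs]
  infer_instance

variable [BorelSpace S]

theorem aemeasurable_symm_chart (G : Metric m S) (x : S) :
    AEMeasurable (extChartAt (𝓡 m) x).symm
      ((volume.restrict (extChartAt (𝓡 m) x).target).withDensity fun z =>
        ENNReal.ofReal (chartWeight G x z)) :=
  ((continuousOn_extChartAt_symm x).aemeasurable
    (isOpen_extChartAt_target x).measurableSet).mono_ac (withDensity_absolutelyContinuous _ _)

theorem integral_chartVolume (G : Metric m S) (x : S) {k : S → F} (hk : Continuous k) :
    ∫ p, k p ∂chartVolume G x = ∫ z in (extChartAt (𝓡 m) x).target,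
      chartWeight G x z • k ((extChartAt (𝓡 m) x).symm z) := by
  have hmeas : AEStronglyMeasurable k (chartVolume G x) :=
    (hk.stronglyMeasurable_of_hasCompactSupport
      (HasCompactSupport.of_compactSpace k)).aestronglyMeasurable
  rw [chartVolume, integral_map (aemeasurable_symm_chart G x) hmeas,
    integral_withDensity_eq_integral_toReal_smul₀
      (((continuousOn_chartWeight G x).aemeasurable
        (isOpen_extChartAt_target x).measurableSet).ennreal_ofReal) (by simp)]
  simp only [ENNReal.toReal_ofReal (chartWeight_nonneg G x _)]

theorem integral_riemannianVolume (G : Metric m S) {s : Finset S}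
    (hs : ∀ x ∉ s, ∀ p, partitionOfUnity m S x p = 0) {k : S → F} (hk : Continuous k) :
    ∫ p, k p ∂riemannianVolume G = ∑ x ∈ s, ∫ z in (extChartAt (𝓡 m) x).target,
      chartWeight G x z • k ((extChartAt (𝓡 m) x).symm z) := by
  have := isFiniteMeasure_chartVolume G
  rw [riemannianVolume_eq_sum G hs, integral_finsetSum_measure fun x _ =>
    hk.integrable_of_hasCompactSupport (HasCompactSupport.of_compactSpace k)]
  exact Finset.sum_congr rfl fun x _ => integral_chartVolume G x hk

theorem integral_eq_setIntegral_chart (G : Metric m S) {x : S} {k : S → F} (hk : Continuous k)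
    (hkx : tsupport k ⊆ (extChartAt (𝓡 m) x).source) :
    ∫ p, k p ∂riemannianVolume G = ∫ z in (extChartAt (𝓡 m) x).target,
      volDensity G x z • k ((extChartAt (𝓡 m) x).symm z) := by
  obtain ⟨s, hs, hs1⟩ := exists_finset_partitionOfUnity m S
  rw [integral_riemannianVolume G hs hk]
  simp only [setIntegral_chartWeight_smul G x _
    fun _ hp => image_eq_zero_of_notMem_tsupport fun h => hp (hkx h)]
  rw [← integral_finsetSum]
  · refine setIntegral_congr_fun (isOpen_extChartAt_target x).measurableSet fun z _ => ?_
    rw [← Finset.smul_sum, ← Finset.sum_smul, hs1, one_smul]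
  · refine fun y _ => integrableOn_chart (isClosed_tsupport k) hkx ?_ fun z _ h => ?_
    · exact (contDiffOn_volDensity G x).continuousOn.smul ((continuousOn_comp_symm_chart
        (partitionOfUnity m S y).contMDiff.continuous x).smul (continuousOn_comp_symm_chart hk x))
    · rw [image_eq_zero_of_notMem_tsupport h, smul_zero, smul_zero]

end Volume

/-! ### Green's formula -/

section IntegrationByParts

theorem tsupport_indicator_subset {X α : Type*} [TopologicalSpace X] [Zero α] {U C : Set X}
    {k : X → α} (hC : IsClosed C) (hk0 : ∀ z ∈ U, z ∉ C → k z = 0) :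
    tsupport (U.indicator k) ⊆ C :=
  closure_minimal (fun z hz => by_contra fun hzC => hz (indicator_apply_eq_zero.2
    fun hzU => hk0 z hzU hzC)) hC

theorem indicator_eventuallyEq_of_mem {X α : Type*} [TopologicalSpace X] [Zero α] {U : Set X}
    {k : X → α} (hU : IsOpen U) {z : X} (hz : z ∈ U) : U.indicator k =ᶠ[𝓝 z] k :=
  eqOn_indicator.eventuallyEq_of_mem (hU.mem_nhds hz)

theorem integrable_indicator_of_continuousOn {X F : Type*} [TopologicalSpace X] [T2Space X]
    [MeasurableSpace X] [OpensMeasurableSpace X] [NormedAddCommGroup F] {μ : Measure X}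
    [IsFiniteMeasureOnCompacts μ] {U C : Set X} {k : X → F} (hU : MeasurableSet U)
    (hC : IsCompact C) (hCU : C ⊆ U) (hk : ContinuousOn k U)
    (hk0 : ∀ z ∈ U, z ∉ C → k z = 0) : Integrable (U.indicator k) μ :=
  (integrable_indicator_iff hU).2 (((hk.mono hCU).integrableOn_compact hC).of_forall_sdiff_eq_zero
    hU fun z hz => hk0 z hz.1 hz.2)

section Derivative

variable {𝕜 E F : Type*} [NontriviallyNormedField 𝕜] [NormedAddCommGroup E] [NormedSpace 𝕜 E]
  [NormedAddCommGroup F] [NormedSpace 𝕜 F] {U : Set E} {k : E → F}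

theorem fderiv_indicator (hU : IsOpen U) (hk : tsupport (U.indicator k) ⊆ U) :
    fderiv 𝕜 (U.indicator k) = U.indicator (fderiv 𝕜 k) := by
  ext1 z
  by_cases hz : z ∈ U
  · rw [indicator_of_mem hz, (indicator_eventuallyEq_of_mem hU hz).fderiv_eq]
  · rw [indicator_of_notMem hz, fderiv_of_notMem_tsupport 𝕜 fun h => hz (hk h)]

theorem differentiable_indicator (hU : IsOpen U) (hk : tsupport (U.indicator k) ⊆ U)
    (hkd : DifferentiableOn 𝕜 k U) : Differentiable 𝕜 (U.indicator k) := fun z => by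
  by_cases hz : z ∈ tsupport (U.indicator k)
  · exact (indicator_eventuallyEq_of_mem hU (hk hz)).differentiableAt_iff.2
      (hkd.differentiableAt (hU.mem_nhds (hk hz)))
  · exact (notMem_tsupport_iff_eventuallyEq.1 hz).differentiableAt_iff.2
      (differentiableAt_const 0)

end Derivative

theorem setIntegral_mul_fderiv_eq_neg_fderiv_mul {E 𝕜 : Type*} [NormedAddCommGroup E]
    [NormedSpace ℝ E] [FiniteDimensional ℝ E] [MeasurableSpace E] [BorelSpace E] [NormedField 𝕜]
    [NormedAlgebra ℝ 𝕜] {μ : Measure E} [μ.IsAddHaarMeasure] {U C : Set E} {k W : E → 𝕜}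
    (hU : IsOpen U) (hC : IsCompact C) (hCU : C ⊆ U)
    (hk : ContDiffOn ℝ 1 k U) (hk0 : ∀ z ∈ U, z ∉ C → k z = 0) (hW : ContDiffOn ℝ 1 W U) (v : E) :
    ∫ z in U, k z * fderiv ℝ W z v ∂μ = -∫ z in U, fderiv ℝ k z v * W z ∂μ := by
  have hts := tsupport_indicator_subset hC.isClosed hk0
  have hderiv (z : E) : fderiv ℝ (U.indicator k) z v = U.indicator (fun z => fderiv ℝ k z v) z := by
    rw [fderiv_indicator hU (hts.trans hCU)]
    by_cases hz : z ∈ U <;> simp [hz]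
  have hk0' : ∀ z ∈ U, z ∉ C → fderiv ℝ k z v = 0 := fun z hzU hzC => by
    have hv := hderiv z
    rw [indicator_of_mem hzU, fderiv_of_notMem_tsupport ℝ fun h => hzC (hts h)] at hv
    exact hv.symm
  have hint {f g : E → 𝕜} (hf : ContinuousOn f U) (hg : ContinuousOn g U)
      (h0 : ∀ z ∈ U, z ∉ C → f z = 0) : Integrable (fun z => U.indicator f z * g z) μ := by
    simp only [← indicator_mul_left]
    exact integrable_indicator_of_continuousOn hU.measurableSet hC hCU (hf.mul hg)
      fun z hzU hzC => mul_eq_zero_of_left (h0 z hzU hzC) _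
  have hcont {f : E → 𝕜} (hf : ContDiffOn ℝ 1 f U) : ContinuousOn (fun z => fderiv ℝ f z v) U :=
    (hf.continuousOn_fderiv_of_isOpen hU le_rfl).clm_apply continuousOn_const
  have hparts := integral_mul_fderiv_eq_neg_fderiv_mul_of_integrable (μ := μ) (v := v)
    (f := U.indicator k) (g := W)
    (by simpa only [hderiv] using hint (hcont hk) hW.continuousOn hk0')
    (hint hk.continuousOn (hcont hW) hk0) (hint hk.continuousOn hW.continuousOn hk0)
    (fun z _ => differentiable_indicator hU (hts.trans hCU) (hk.differentiableOn one_ne_zero) z)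
    fun z hz => (hW.differentiableOn one_ne_zero).differentiableAt
      (hU.mem_nhds (hCU (hts hz)))
  have hindicator (f g : E → 𝕜) :
      ∫ z, U.indicator f z * g z ∂μ = ∫ z in U, f z * g z ∂μ := by
    simp only [← indicator_mul_left, integral_indicator hU.measurableSet]
  simpa only [hderiv, hindicator] using hparts

end IntegrationByParts

section Green

variable {m : ℕ} {S : Type*} [TopologicalSpace S] [ChartedSpace (EuclideanSpace ℝ (Fin m)) S]

theorem continuous_of_continuousOn_charts {Y : Type*} [TopologicalSpace Y] {k : S → Y}
    (hk : ∀ x, ContinuousOn (fun z => k ((extChartAt (𝓡 m) x).symm z))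
      (extChartAt (𝓡 m) x).target) : Continuous k := by
  refine continuous_iff_continuousAt.2 fun p => ?_
  have hcomp : ContinuousOn (fun q => k ((extChartAt (𝓡 m) p).symm (extChartAt (𝓡 m) p q)))
      (extChartAt (𝓡 m) p).source :=
    (hk p).comp (continuousOn_extChartAt p) fun q hq => (extChartAt (𝓡 m) p).map_source hq
  exact (hcomp.congr fun q hq => (congrArg k ((extChartAt (𝓡 m) p).left_inv hq)).symm).continuousAt
    (extChartAt_source_mem_nhds p)

variable [IsManifold (𝓡 m) ∞ S]

theorem contDiffOn_partials_comp_symm_chart {f : S → ℂ} (hf : ContMDiff (𝓡 m) 𝓘(ℝ, ℂ) ∞ f) (x : S)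
    (A : Fin m) : ContDiffOn ℝ ∞ (fun z => partials (f ∘ (extChartAt (𝓡 m) x).symm) z A)
      (extChartAt (𝓡 m) x).target :=
  ((contDiffOn_comp_symm_chart hf x).fderiv_of_isOpen (isOpen_extChartAt_target x)
    (by simp)).clm_apply contDiffOn_const

/-- The vector field `√G G^{AB} ∂_B F` in the chart around `x`. -/
noncomputable def chartFlux (G : Metric m S) (x : S) (F : EuclideanSpace ℝ (Fin m) → ℂ) (A : Fin m)
    (z : EuclideanSpace ℝ (Fin m)) : ℂ :=
  ∑ B, (volDensity G x z * (metricMatrix G x z)⁻¹ A B) • partials F z B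

theorem contDiffOn_chartFlux (G : Metric m S) {f : S → ℂ} (hf : ContMDiff (𝓡 m) 𝓘(ℝ, ℂ) ∞ f)
    (x : S) (A : Fin m) :
    ContDiffOn ℝ ∞ (chartFlux G x (f ∘ (extChartAt (𝓡 m) x).symm) A)
      (extChartAt (𝓡 m) x).target :=
  ContDiffOn.sum fun B _ => ((contDiffOn_volDensity G x).mul
    (contDiffOn_metricMatrix_inv G x A B)).smul (contDiffOn_partials_comp_symm_chart hf x B)

theorem continuousOn_partials_chartFlux (G : Metric m S) {f : S → ℂ}
    (hf : ContMDiff (𝓡 m) 𝓘(ℝ, ℂ) ∞ f) (x : S) (A : Fin m) :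
    ContinuousOn (fun z => partials (chartFlux G x (f ∘ (extChartAt (𝓡 m) x).symm) A) z A)
      (extChartAt (𝓡 m) x).target :=
  ((contDiffOn_chartFlux G hf x A).continuousOn_fderiv_of_isOpen (isOpen_extChartAt_target x)
    (by simp)).clm_apply continuousOn_const

theorem chartLaplacian_eq_divergence (G : Metric m S) (x : S)
    (F : EuclideanSpace ℝ (Fin m) → ℂ) (z : EuclideanSpace ℝ (Fin m)) :
    chartLaplacian G x F z = (volDensity G x z)⁻¹ • ∑ A, partials (chartFlux G x F A) z A :=
  rfl

theorem volDensity_smul_chartLaplacian (G : Metric m S) (x : S)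
    (F : EuclideanSpace ℝ (Fin m) → ℂ) {z : EuclideanSpace ℝ (Fin m)}
    (hz : z ∈ (extChartAt (𝓡 m) x).target) :
    volDensity G x z • chartLaplacian G x F z = ∑ A, partials (chartFlux G x F A) z A := by
  rw [chartLaplacian_eq_divergence, smul_inv_smul₀ (volDensity_pos G x hz).ne']

theorem volDensity_smul_chartPairing (G : Metric m S) (x : S)
    (F H : EuclideanSpace ℝ (Fin m) → ℂ) (z : EuclideanSpace ℝ (Fin m)) :
    volDensity G x z • chartPairing G x F H z = ∑ A, partials F z A * chartFlux G x H A z := by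
  simp only [chartPairing, chartFlux, dotProduct, Matrix.mulVec, Matrix.map_apply, Finset.mul_sum,
    Finset.smul_sum, Complex.real_smul, Complex.ofReal_mul, Complex.ofRealHom_eq_coe]
  exact Finset.sum_congr rfl fun A _ => Finset.sum_congr rfl fun B _ => by ring

theorem HasLaplacian.continuous {G : Metric m S} {f h : S → ℂ} (H : HasLaplacian G f h) :
    Continuous h :=
  continuous_of_continuousOn_charts (m := m) fun x =>
    (((contDiffOn_volDensity G x).continuousOn.inv₀ fun _ hz => (volDensity_pos G x hz).ne').smul
      (continuousOn_finsetSum _ fun A _ => continuousOn_partials_chartFlux G H.1 x A)).congr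
      fun z hz => (H.2 x z hz).symm

theorem partials_star (F : EuclideanSpace ℝ (Fin m) → ℂ) (z : EuclideanSpace ℝ (Fin m)) :
    partials (fun w => star (F w)) z = star (partials F z) := by
  ext A
  simp only [partials, fderiv_star]
  rfl

theorem chartFlux_star (G : Metric m S) (x : S) (F : EuclideanSpace ℝ (Fin m) → ℂ) (A : Fin m) :
    chartFlux G x (fun w => star (F w)) A = fun z => star (chartFlux G x F A z) := by
  ext z
  simp only [chartFlux, partials_star, Pi.star_apply, star_sum, star_smul, star_trivial]

theorem hasLaplacian_star {G : Metric m S} {f h : S → ℂ} (H : HasLaplacian G f h) :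
    HasLaplacian G (fun p => star (f p)) (fun p => star (h p)) := by
  refine ⟨Complex.conjCLE.contDiff.contMDiff.comp H.1, fun x z hz => ?_⟩
  have hreal : chartLaplacian G x (fun w => star ((f ∘ (extChartAt (𝓡 m) x).symm) w)) z
      = star (chartLaplacian G x (f ∘ (extChartAt (𝓡 m) x).symm) z) := by
    simp only [chartLaplacian_eq_divergence, chartFlux_star, partials_star, Pi.star_apply,
      star_smul, star_sum, star_trivial]
  exact hreal.trans (congrArg star (H.2 x z hz))

theorem continuous_gradPairing (G : Metric m S) {f h : S → ℂ} (hf : ContMDiff (𝓡 m) 𝓘(ℝ, ℂ) ∞ f)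
    (hh : ContMDiff (𝓡 m) 𝓘(ℝ, ℂ) ∞ h) : Continuous (gradPairing G f h) := by
  refine continuous_of_continuousOn_charts (m := m) fun x => ?_
  have hchart : ContinuousOn (chartPairing G x (f ∘ (extChartAt (𝓡 m) x).symm)
      (h ∘ (extChartAt (𝓡 m) x).symm)) (extChartAt (𝓡 m) x).target := by
    unfold chartPairing
    simp only [dotProduct, Matrix.mulVec, Matrix.map_apply, Complex.ofRealHom_eq_coe]
    exact continuousOn_finsetSum _ fun A _ =>
      (contDiffOn_partials_comp_symm_chart hf x A).continuousOn.mul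
        (continuousOn_finsetSum _ fun B _ => (Complex.continuous_ofReal.comp_continuousOn
          (contDiffOn_metricMatrix_inv G x A B).continuousOn).mul
            (contDiffOn_partials_comp_symm_chart hh x B).continuousOn)
  exact hchart.congr fun z hz => gradPairing_symm_chart G hf hh hz

theorem gradPairing_comm (G : Metric m S) (f h : S → ℂ) (p : S) :
    gradPairing G f h p = gradPairing G h f p := by
  have hsymm : (metricMatrix G p (extChartAt (𝓡 m) p p))⁻¹.transpose
      = (metricMatrix G p (extChartAt (𝓡 m) p p))⁻¹ := by
    rw [← Matrix.conjTranspose_eq_transpose_of_trivial]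
    exact (posDef_metricMatrix G p (mem_extChartAt_target p)).isHermitian.inv
  rw [gradPairing, gradPairing, chartPairing, chartPairing, Matrix.dotProduct_mulVec,
    ← Matrix.mulVec_transpose, ← Matrix.transpose_map, hsymm, dotProduct_comm]

theorem partials_comp_symm_chart_eq_zero {f : S → ℂ} {x : S} {z : EuclideanSpace ℝ (Fin m)}
    (hz : z ∈ (extChartAt (𝓡 m) x).target) (hf : (extChartAt (𝓡 m) x).symm z ∉ tsupport f) :
    partials (f ∘ (extChartAt (𝓡 m) x).symm) z = 0 := by
  have hzero : f ∘ (extChartAt (𝓡 m) x).symm =ᶠ[𝓝 z] fun _ => (0 : ℂ) :=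
    (mdifferentiableAt_symm_chart hz).continuousAt.eventually
      (notMem_tsupport_iff_eventuallyEq.1 hf)
  ext A
  rw [partials, hzero.fderiv_eq, fderiv_fun_const]
  rfl

theorem tsupport_gradPairing_subset (G : Metric m S) (f h : S → ℂ) :
    tsupport (gradPairing G f h) ⊆ tsupport f :=
  closure_minimal (fun p hp => by_contra fun hpf => hp (by
    rw [gradPairing, chartPairing, partials_comp_symm_chart_eq_zero (mem_extChartAt_target p)
      (by rwa [extChartAt_to_inv]), zero_dotProduct])) (isClosed_tsupport f)

theorem gradPairing_sum (G : Metric m S) {ι : Type*} (s : Finset ι) {f : ι → S → ℂ}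
    (hf : ∀ i ∈ s, ContMDiff (𝓡 m) 𝓘(ℝ, ℂ) ∞ (f i)) (h : S → ℂ) (p : S) :
    gradPairing G (fun q => ∑ i ∈ s, f i q) h p = ∑ i ∈ s, gradPairing G (f i) h p := by
  have hpartials : partials ((fun q => ∑ i ∈ s, f i q) ∘ (extChartAt (𝓡 m) p).symm)
      (extChartAt (𝓡 m) p p)
      = ∑ i ∈ s, partials (f i ∘ (extChartAt (𝓡 m) p).symm) (extChartAt (𝓡 m) p p) := by
    have hsum : fderiv ℝ ((fun q => ∑ i ∈ s, f i q) ∘ (extChartAt (𝓡 m) p).symm)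
        (extChartAt (𝓡 m) p p)
        = ∑ i ∈ s, fderiv ℝ (f i ∘ (extChartAt (𝓡 m) p).symm) (extChartAt (𝓡 m) p p) :=
      fderiv_fun_sum fun i hi =>
        differentiableAt_comp_symm_chart (hf i hi) (mem_extChartAt_target p)
    ext A
    simp only [partials, hsum, FunLike.coe_sum, Finset.sum_apply]
  simp only [gradPairing, chartPairing, hpartials, sum_dotProduct]

variable [CompactSpace S]

theorem setIntegral_mul_partials_chartFlux (G : Metric m S) {f k : S → ℂ} {x : S}
    (hf : ContMDiff (𝓡 m) 𝓘(ℝ, ℂ) ∞ f) (hk : ContMDiff (𝓡 m) 𝓘(ℝ, ℂ) ∞ k)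
    (hkx : tsupport k ⊆ (extChartAt (𝓡 m) x).source) (A : Fin m) :
    ∫ z in (extChartAt (𝓡 m) x).target, k ((extChartAt (𝓡 m) x).symm z) *
        partials (chartFlux G x (f ∘ (extChartAt (𝓡 m) x).symm) A) z A
      = -∫ z in (extChartAt (𝓡 m) x).target, partials (k ∘ (extChartAt (𝓡 m) x).symm) z A *
          chartFlux G x (f ∘ (extChartAt (𝓡 m) x).symm) A z :=
  setIntegral_mul_fderiv_eq_neg_fderiv_mul (k := k ∘ (extChartAt (𝓡 m) x).symm)
    (isOpen_extChartAt_target x) (isCompact_image_chart (isClosed_tsupport k) hkx)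
    (image_chart_subset_target hkx) ((contDiffOn_comp_symm_chart hk x).of_le (by simp))
    (fun _ hz hzk => image_eq_zero_of_notMem_tsupport (f := k) (symm_chart_notMem hz hzk))
    ((contDiffOn_chartFlux G hf x A).of_le (by simp)) _

variable [T2Space S] [MeasurableSpace S] [BorelSpace S]

theorem integral_mul_laplacian_of_tsupport_subset {G : Metric m S} {f h k : S → ℂ} {x : S}
    (H : HasLaplacian G f h) (hk : ContMDiff (𝓡 m) 𝓘(ℝ, ℂ) ∞ k)
    (hkx : tsupport k ⊆ (extChartAt (𝓡 m) x).source) :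
    ∫ p, k p * h p ∂riemannianVolume G = -∫ p, gradPairing G k f p ∂riemannianVolume G := by
  have hmeas := (isOpen_extChartAt_target (I := 𝓡 m) x).measurableSet
  calc ∫ p, k p * h p ∂riemannianVolume G
    _ = ∫ z in (extChartAt (𝓡 m) x).target, volDensity G x z •
        (k ((extChartAt (𝓡 m) x).symm z) * h ((extChartAt (𝓡 m) x).symm z)) :=
      integral_eq_setIntegral_chart G (hk.continuous.mul H.continuous)
        (tsupport_mul_subset_left.trans hkx)
    _ = ∫ z in (extChartAt (𝓡 m) x).target, ∑ A, k ((extChartAt (𝓡 m) x).symm z) *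
        partials (chartFlux G x (f ∘ (extChartAt (𝓡 m) x).symm) A) z A :=
      setIntegral_congr_fun hmeas fun z hz => by
        simp only [← Finset.mul_sum, ← volDensity_smul_chartLaplacian G x _ hz, H.2 x z hz,
          mul_smul_comm]
    _ = ∑ A, ∫ z in (extChartAt (𝓡 m) x).target, k ((extChartAt (𝓡 m) x).symm z) *
        partials (chartFlux G x (f ∘ (extChartAt (𝓡 m) x).symm) A) z A :=
      integral_finsetSum _ fun A _ => integrableOn_chart (isClosed_tsupport k) hkx
        ((continuousOn_comp_symm_chart hk.continuous x).mul
          (continuousOn_partials_chartFlux G H.1 x A)) fun z _ hz => by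
            rw [image_eq_zero_of_notMem_tsupport hz, zero_mul]
    _ = -∑ A, ∫ z in (extChartAt (𝓡 m) x).target,
        partials (k ∘ (extChartAt (𝓡 m) x).symm) z A *
          chartFlux G x (f ∘ (extChartAt (𝓡 m) x).symm) A z := by
      simp only [setIntegral_mul_partials_chartFlux G H.1 hk hkx, Finset.sum_neg_distrib]
    _ = -∫ z in (extChartAt (𝓡 m) x).target, ∑ A,
        partials (k ∘ (extChartAt (𝓡 m) x).symm) z A *
          chartFlux G x (f ∘ (extChartAt (𝓡 m) x).symm) A z :=
      congrArg _ (integral_finsetSum _ fun A _ => integrableOn_chart (isClosed_tsupport k) hkx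
        ((contDiffOn_partials_comp_symm_chart hk x A).continuousOn.mul
          (contDiffOn_chartFlux G H.1 x A).continuousOn) fun z hz hzk => by
            simp only [Pi.mul_apply, partials_comp_symm_chart_eq_zero hz hzk, Pi.zero_apply,
              zero_mul]).symm
    _ = -∫ z in (extChartAt (𝓡 m) x).target,
        volDensity G x z • gradPairing G k f ((extChartAt (𝓡 m) x).symm z) :=
      congrArg _ (setIntegral_congr_fun hmeas fun z hz => by
        simp only [gradPairing_symm_chart G hk H.1 hz, volDensity_smul_chartPairing])
    _ = -∫ p, gradPairing G k f p ∂riemannianVolume G :=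
      congrArg _ (integral_eq_setIntegral_chart G (continuous_gradPairing G hk H.1)
        ((tsupport_gradPairing_subset G k f).trans hkx)).symm

theorem integral_mul_laplacian {G : Metric m S} {f h k : S → ℂ}
    (H : HasLaplacian G f h) (hk : ContMDiff (𝓡 m) 𝓘(ℝ, ℂ) ∞ k) :
    ∫ p, k p * h p ∂riemannianVolume G = -∫ p, gradPairing G k f p ∂riemannianVolume G := by
  have := isFiniteMeasure_riemannianVolume G
  obtain ⟨s, -, hs⟩ := exists_finset_partitionOfUnity m S
  let piece (x p : S) : ℂ := partitionOfUnity m S x p • k p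
  have hpiece (x : S) : ContMDiff (𝓡 m) 𝓘(ℝ, ℂ) ∞ (piece x) :=
    (partitionOfUnity m S x).contMDiff.smul hk
  have hpiece_tsupport (x : S) : tsupport (piece x) ⊆ (extChartAt (𝓡 m) x).source :=
    (tsupport_smul_subset_left _ _).trans (tsupport_partitionOfUnity_subset x)
  have hsum : k = fun p => ∑ x ∈ s, piece x p := by
    ext p
    rw [← Finset.sum_smul, hs, one_smul]
  have hleft (p : S) : k p * h p = ∑ x ∈ s, piece x p * h p := by
    rw [← Finset.sum_mul, ← congrFun hsum p]
  have hright (p : S) : gradPairing G k f p = ∑ x ∈ s, gradPairing G (piece x) f p := by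
    rw [← gradPairing_sum G s fun x _ => hpiece x, ← hsum]
  have hint {g : S → ℂ} (hg : Continuous g) : Integrable g (riemannianVolume G) :=
    hg.integrable_of_hasCompactSupport (HasCompactSupport.of_compactSpace g)
  simp only [hleft, hright]
  rw [integral_finsetSum s (f := fun x p => piece x p * h p) fun x _ =>
      hint ((hpiece x).continuous.mul H.continuous),
    integral_finsetSum _ fun x _ => hint (continuous_gradPairing G (hpiece x) H.1),
    ← Finset.sum_neg_distrib]
  exact Finset.sum_congr rfl fun x _ =>
    integral_mul_laplacian_of_tsupport_subset H (hpiece x) (hpiece_tsupport x)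

theorem integral_mul_laplacian_comm {G : Metric m S} {f h f' h' : S → ℂ}
    (H : HasLaplacian G f h) (H' : HasLaplacian G f' h') :
    ∫ p, f p * h' p ∂riemannianVolume G = ∫ p, f' p * h p ∂riemannianVolume G := by
  simp only [integral_mul_laplacian H' H.1, integral_mul_laplacian H H'.1,
    gradPairing_comm G f f']

theorem inner_laplacian {G : Metric m S} {K F K' F' : L2Matter G} (h : IsLaplacianOf G K F)
    (h' : IsLaplacianOf G K' F') : ⟪K, F'⟫_ℂ = ⟪F, K'⟫_ℂ := by
  obtain ⟨f, l, H, hF, hK⟩ := h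
  obtain ⟨f', l', H', hF', hK'⟩ := h'
  have hleft : ⟪K, F'⟫_ℂ = ∫ p, f' p * star (l p) ∂riemannianVolume G := by
    rw [L2.inner_def]
    refine integral_congr_ae ?_
    filter_upwards [hK, hF'] with p hKp hFp
    rw [hKp, hFp, RCLike.inner_apply, starRingEnd_apply]
  have hright : ⟪F, K'⟫_ℂ = ∫ p, star (f p) * l' p ∂riemannianVolume G := by
    rw [L2.inner_def]
    refine integral_congr_ae ?_
    filter_upwards [hF, hK'] with p hFp hKp
    rw [hFp, hKp, RCLike.inner_apply, starRingEnd_apply, mul_comm]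
  rw [hleft, hright, integral_mul_laplacian_comm (hasLaplacian_star H) H']

end Green

/-! ### Selfadjointness of the Hamilton operator -/

section Hamiltonian

variable {m : ℕ} {S : Type*} [TopologicalSpace S] [ChartedSpace (EuclideanSpace ℝ (Fin m)) S]
  [IsManifold (𝓡 m) ∞ S] [T2Space S] [CompactSpace S] [MeasurableSpace S]

theorem span_eigenvectors (G : Metric m S) (n : ℕ) (αM : ℝ) :
    Submodule.span ℂ {F : H0 G n αM | ∃ μ : ℝ,
      4 / (n : ℝ) ^ 2 * a0 n αM * μ - ((m : ℝ) - 1) ^ 2 / 4 ≤ 0 ∧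
        IsLaplacianOf G ((-(μ : ℂ) • F : H0 G n αM) : L2Matter G) (F : L2Matter G)} = ⊤ := by
  refine top_le_iff.1 ((Submodule.span_span_coe_preimage (R := ℂ)).ge.trans
    (Submodule.span_mono ?_))
  rintro ⟨F, _⟩ ⟨μ, hμ, f, hf, hF⟩
  refine ⟨μ, hμ, f, _, hf, hF, (Lp.coeFn_smul (-(μ : ℂ)) F).trans ?_⟩
  filter_upwards [hF] with y hy
  rw [Pi.smul_apply, hy, smul_eq_mul, neg_mul]

theorem wave_radialPart {G : Metric m S} {n : ℕ} {αM : ℝ} {I : Set ℝ} (A B p : ℝ) (u : TestFn I)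
    (F : H0 G n αM) :
    wave (radialPart I A B p u) F = wave (TestFn.radialKinetic I u) F
      + (A : ℂ) • wave (TestFn.rpowMul I 2 u) F - (B : ℂ) • wave (TestFn.rpowMul I p u) F := by
  change pureTensor (TestFn.toL2 I (radialPart I A B p u)) F
    = pureTensor (TestFn.toL2 I (TestFn.radialKinetic I u)) F
      + (A : ℂ) • pureTensor (TestFn.toL2 I (TestFn.rpowMul I 2 u)) F
      - (B : ℂ) • pureTensor (TestFn.toL2 I (TestFn.rpowMul I p u)) F
  simp only [radialPart, LinearMap.add_apply, LinearMap.sub_apply, LinearMap.smul_apply, map_add,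
    map_sub, map_smul, add_sub_assoc]

/-- The multiplication operator `(16/n²) (V̄ + Λ̄) r² - (16/n²) κ r^{2(n-2)/n}` in `H`. -/
noncomputable def hamiltonianPotential (n : ℕ) (αM V Λ κ : ℝ) : ℝ → ℝ :=
  radialPotential (16 / (n : ℝ) ^ 2 * (VBar n αM V + LambdaBar n Λ)) (16 / (n : ℝ) ^ 2 * κ)
    (2 * ((n : ℝ) - 2) / n)

theorem hamiltonianGraph_eq_separatedGraph (G : Metric m S) (n : ℕ) (αM V Λ κ : ℝ) (I : Set ℝ) :
    hamiltonianGraph G n αM V Λ κ I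
      = separatedGraph (fun K F : H0 G n αM => IsLaplacianOf G (K : L2Matter G) (F : L2Matter G))
        (TestFn.toL2 I)
        (fun u => TestFn.toL2 I (radialPart I (16 / (n : ℝ) ^ 2 * (VBar n αM V + LambdaBar n Λ))
          (16 / (n : ℝ) ^ 2 * κ) (2 * ((n : ℝ) - 2) / n) u))
        (fun u => TestFn.toL2 I (TestFn.rpowMul I (-2) u))
        (4 / (n : ℝ) ^ 2 * a0 n αM) (((m : ℝ) - 1) ^ 2 / 4) := by
  refine congrArg (Submodule.span ℂ) (Set.ext fun q => exists₃_congr fun u F K =>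
    and_congr_right fun _ => ?_)
  rw [Prod.ext_iff]
  refine and_congr_right fun _ => Eq.congr_right ?_
  change _ = wave (radialPart I _ _ _ u) F + wave (TestFn.rpowMul I (-2) u) _
  rw [wave_radialPart]
  push_cast
  abel

theorem zero_le_exponent {n : ℕ} (hn : 2 ≤ n) : 0 ≤ 2 * ((n : ℝ) - 2) / n := by
  have hn' : (2 : ℝ) ≤ n := by exact_mod_cast hn
  exact div_nonneg (by linarith) (by linarith)

theorem exponent_lt_two {n : ℕ} (hn : 2 ≤ n) : 2 * ((n : ℝ) - 2) / n < 2 := by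
  have hn' : (2 : ℝ) ≤ n := by exact_mod_cast hn
  rw [div_lt_iff₀ (by linarith)]
  linarith

theorem bddAbove_hamiltonianPotential_image {n : ℕ} (hn : 2 ≤ n) {αM V Λ κ : ℝ} {I : Set ℝ}
    (hpos : I ⊆ Ioi 0) (h : BddAbove I ∨ (VBar n αM V + LambdaBar n Λ ≤ 0 ∧ 0 ≤ κ) ∨
      VBar n αM V + LambdaBar n Λ < 0) : BddAbove (hamiltonianPotential n αM V Λ κ '' I) := by
  have hcoeff : 0 < 16 / (n : ℝ) ^ 2 := by positivity
  rcases h with hbdd | ⟨hV, hκ⟩ | hV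
  · exact bddAbove_radialPotential_image_of_bddAbove _ _ (zero_le_exponent hn) hpos hbdd
  · exact bddAbove_radialPotential_image_of_nonpos _
      (mul_nonpos_of_nonneg_of_nonpos hcoeff.le hV) (mul_nonneg hcoeff.le hκ) hpos
  · exact bddAbove_radialPotential_image_of_neg (mul_neg_of_pos_of_neg hcoeff hV) _
      (zero_le_exponent hn) (exponent_lt_two hn) hpos

theorem hamiltonianSelfAdjoint_of_bddAbove [BorelSpace S] (G : Metric m S) {n : ℕ} (hn : 2 ≤ n)
    {αM V Λ κ : ℝ} {I : Set ℝ} (hI : IsOpen I) (hpos : I ⊆ Ioi 0)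
    (hbdd : BddAbove (hamiltonianPotential n αM V Λ κ '' I)) :
    HamiltonianSelfAdjoint G n αM V Λ κ I := by
  obtain ⟨c, hc⟩ := hbdd
  obtain ⟨d, hd⟩ := exists_inner_radialPart_eq hI (zero_le_exponent hn) (forall_mem_image.1 hc)
  have hL {K F K' F' : H0 G n αM} (h : IsLaplacianOf G (K : L2Matter G) (F : L2Matter G))
      (h' : IsLaplacianOf G (K' : L2Matter G) (F' : L2Matter G)) : ⟪K, F'⟫_ℂ = ⟪F, K'⟫_ℂ :=
    inner_laplacian h h'
  rw [HamiltonianSelfAdjoint, hamiltonianGraph_eq_separatedGraph]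
  exact isSelfAdjointInFriedrichsSense_separatedGraph hL (span_eigenvectors G n αM)
    (denseRange_toL2 hI hpos) hd (inner_rpowMul_neg_two hI hpos)

end Hamiltonian

end FriedmanQC

theorem theorem1p4_general {m : ℕ} {S : Type*} [TopologicalSpace S]
    [ChartedSpace (EuclideanSpace ℝ (Fin m)) S] [IsManifold (𝓡 m) ∞ S] [T2Space S]
    [CompactSpace S] [MeasurableSpace S] [BorelSpace S] (G : FriedmanQC.Metric m S)
    (n : ℕ) (hn : 2 ≤ n) (αM : ℝ) (_hαM : αM ≠ 0) (V Λ κ : ℝ) {I : Set ℝ} (hI : IsOpen I)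
    (hpos : I ⊆ Ioi 0)
    (h : BddAbove I ∨ (FriedmanQC.VBar n αM V + FriedmanQC.LambdaBar n Λ ≤ 0 ∧ 0 ≤ κ) ∨
      FriedmanQC.VBar n αM V + FriedmanQC.LambdaBar n Λ < 0) :
    FriedmanQC.HamiltonianSelfAdjoint G n αM V Λ κ I :=
  FriedmanQC.hamiltonianSelfAdjoint_of_bddAbove G hn hI hpos
    (FriedmanQC.bddAbove_hamiltonianPotential_image hn hpos h)

theorem theorem1p4 {m : ℕ} (hm : 1 ≤ m) {S : Type*} [TopologicalSpace S]
    [ChartedSpace (EuclideanSpace ℝ (Fin m)) S] [IsManifold (𝓡 m) ∞ S] [T2Space S]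
    [CompactSpace S] [MeasurableSpace S] [BorelSpace S] (G : FriedmanQC.Metric m S)
    (n : ℕ) (hn : 2 ≤ n) (αM : ℝ) (hαM : 0 < αM) (V Λ κ : ℝ) :
    (∀ r₀ : ℝ, 0 < r₀ →
      FriedmanQC.HamiltonianSelfAdjoint G n αM V Λ κ (Ioo 0 r₀)) ∧
    ((FriedmanQC.VBar n αM V + FriedmanQC.LambdaBar n Λ ≤ 0 ∧ 0 ≤ κ) ∨
        FriedmanQC.VBar n αM V + FriedmanQC.LambdaBar n Λ < 0 →
      FriedmanQC.HamiltonianSelfAdjoint G n αM V Λ κ (Ioi 0)) :=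
  ⟨fun _ _ => theorem1p4_general G n hn αM hαM.ne' V Λ κ isOpen_Ioo Ioo_subset_Ioi_self
    (.inl bddAbove_Ioo), fun h => theorem1p4_general G n hn αM hαM.ne' V Λ κ isOpen_Ioi subset_rfl
    (.inr h)⟩
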